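/- Let $M$ be a smooth manifold. For a smooth real vector bundle $V\to M$ of finite rank with a bundle map $\rho_V:V\to TM$ (the anchor), a *right-anchored product* on $(V,M,\rho_V)$ is an $\mathbb R$-bilinear map $T:\Gamma(V)\times\Gamma(V)\to\Gamma(V)$, $(a,b)\mapsto T_ab$, with $T_{fa}b=f\,T_ab$ and $T_a(fb)=f\,T_ab+\rho_V(a)(f)\,b$ for all $f\in C^\infty(M)$. Put $[a,b]_T=T_ab-T_ba$ and $R^T(a,b)c=T_aT_bc-T_bT_ac-T_{[a,b]_T}c$. One calls $(V,M,\rho_V,T)$ a *left symmetric algebroid* if $R^T=0$. Let $(A,M,\rho,S)$ be a left symmetric algebroid, with dual bundle $A^*$ and pairing $\prec\cdot,\cdot\succ$. For $X\in\Gamma(A)$ and $\alpha\in\Gamma(A^*)$ let $S_X^*\alpha\in\Gamma(A^*)$ be given by $\prec S_X^*\alpha,Y\succ=\rho(X).\prec\alpha,Y\succ-\prec\alpha,S_XY\succ$. For an $\mathbb R$-bilinear $B:\Gamma(A^*)\times\Gamma(A^*)\to C^\infty(M)$ put $$(S_XB)(\alpha,\beta)=\rho(X).B(\alpha,\beta)-B(S_X^*\alpha,\beta)-B(\alpha,S_X^*\beta),\qquad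 S^2_{X,Y}B=S_X(S_YB)-S_{S_XY}B .$$ Let $r=\mathfrak a+\mathfrak s\in\Gamma(A\otimes A)$, where $\mathfrak a$ is the skew-symmetric and $\mathfrak s$ the symmetric part of $r$. Let $r_\#:A^*\to A$ be given by $\beta(r_\#(\alpha))=r(\alpha,\beta)$, and let $\rho_r=\rho\circ r_\#$. The formula $$\prec T_\alpha\beta,X\succ=(S_Xr)(\alpha,\beta)+\prec S^*_{r_\#(\alpha)}\beta,X\succ$$ defines a right-anchored product $T$ on $(A^*,M,\rho_r)$. Put $$\Delta(r)(\alpha,\beta)=r_\#([\alpha,\beta]_T)-[r_\#(\alpha),r_\#(\beta)]_S,$$ $$Q_X\Delta(r)(\alpha,\beta)=[X,\Delta(r)(\alpha,\beta)]_S-\Delta(r)(S_X^*\alpha,\beta)-\Delta(r)(\alpha,S_X^*\beta).$$ For $\alpha\in\Gamma(A^*)$ and $X\in\Gamma(A)$ let $T_\alpha^*X\in\Gamma(A)$ be given by $\prec\beta,T^*_\alpha X\succ=\rho_r(\alpha).\prec\beta,X\succ-\prec T_\alpha\beta,X\succ$. On $\Gamma(A\oplus A^*)$ put $$\nabla_{X+\alpha}(Y+\beta)=S_XY+T^*_\alpha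 Y+S^*_X\beta+T_\alpha\beta,$$ and let $R^\nabla(a,b)c=\nabla_a\nabla_bc-\nabla_b\nabla_ac-\nabla_{\nabla_ab-\nabla_ba}c$. The products $S$ and $T$ are called *compatible* if, for all $X,Y\in\Gamma(A)$ and $\alpha,\beta\in\Gamma(A^*)$, $$R^\nabla(X,\alpha)Y=R^\nabla(Y,\alpha)X\quad\text{and}\quad R^\nabla(\alpha,X)\beta=R^\nabla(\beta,X)\alpha .$$ **Theorem.** $(A^*,M,\rho_r,T)$ is a left symmetric algebroid and is compatible with $(A,M,\rho,S)$ if and only if, for all $X,Y\in\Gamma(A)$ and $\alpha,\beta\in\Gamma(A^*)$, $$\rho\bigl(\Delta(r)(\alpha,\beta)\bigr)=0,\qquad (S^2_{X,Y}\mathfrak a)(\alpha,\beta)=0,\qquad Q_X\Delta(r)(\alpha,\beta)=0 .$$ -/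

import Mathlib

open Bundle
open scoped Manifold ContDiff TensorProduct Topology

namespace LSAlgebroid
noncomputable section

section Basic
variable {E : Type*} [NormedAddCommGroup E] [NormedSpace ℝ E]
  {H : Type*} [TopologicalSpace H] {I : ModelWithCorners ℝ E H}
  {M : Type*} [TopologicalSpace M] [ChartedSpace H M]
  {F : Type*} [NormedAddCommGroup F] [NormedSpace ℝ F]
  {V : M → Type*} [TopologicalSpace (TotalSpace F V)]
  [∀ x, AddCommGroup (V x)] [∀ x, Module ℝ (V x)] [∀ x, TopologicalSpace (V x)]
  [FiberBundle F V] [VectorBundle ℝ F V]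
  {F' : Type*} [NormedAddCommGroup F'] [NormedSpace ℝ F']
  {W : M → Type*} [TopologicalSpace (TotalSpace F' W)]
  [∀ x, AddCommGroup (W x)] [∀ x, Module ℝ (W x)] [∀ x, TopologicalSpace (W x)]
  [∀ x, IsTopologicalAddGroup (W x)] [∀ x, ContinuousSMul ℝ (W x)]
  [FiberBundle F' W] [VectorBundle ℝ F' W]

/-- The product of a smooth function and a smooth section. -/
instance instSMulSection : SMul C^∞⟮I, M; ℝ⟯ Cₛ^∞⟮I; F, V⟯ :=
  ⟨fun f s => ⟨fun x => f x • s x, f.contMDiff.smul_section s.contMDiff⟩⟩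

theorem smul_section_apply (f : C^∞⟮I, M; ℝ⟯) (s : Cₛ^∞⟮I; F, V⟯) (x : M) :
    (f • s) x = f x • s x := rfl

/-- A smooth section of the homomorphism bundle `Hom(V, W)` applied to a smooth section of `V`. -/
def applySection (Φ : Cₛ^∞⟮I; F →L[ℝ] F', fun x => V x →L[ℝ] W x⟯) (s : Cₛ^∞⟮I; F, V⟯) :
    Cₛ^∞⟮I; F', W⟯ :=
  ⟨fun x => Φ x (s x), ContMDiff.clm_bundle_apply Φ.contMDiff s.contMDiff⟩

theorem applySection_apply (Φ : Cₛ^∞⟮I; F →L[ℝ] F', fun x => V x →L[ℝ] W x⟯)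
    (s : Cₛ^∞⟮I; F, V⟯) (x : M) : applySection Φ s x = Φ x (s x) := rfl

/-- The dual vector bundle `V*`. -/
abbrev DualBundle (V : M → Type*) [∀ x, AddCommGroup (V x)] [∀ x, Module ℝ (V x)]
    [∀ x, TopologicalSpace (V x)] (x : M) : Type _ := V x →L[ℝ] ℝ

/-- The natural pairing of a section of `V*` with a section of `V`. -/
def pairing (α : Cₛ^∞⟮I; F →L[ℝ] ℝ, DualBundle V⟯) (s : Cₛ^∞⟮I; F, V⟯) : C^∞⟮I, M; ℝ⟯ :=
  ⟨fun x => α x (s x), fun x => by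
    have h : ContMDiff I (I.prod 𝓘(ℝ, ℝ)) ∞
        (fun m => TotalSpace.mk' ℝ (E := fun _ : M => ℝ) m (α m (s m))) :=
      ContMDiff.clm_bundle_apply (E₂ := fun _ : M => ℝ) α.contMDiff s.contMDiff
    exact (contMDiffAt_totalSpace.1 (h x)).2⟩

theorem pairing_apply (α : Cₛ^∞⟮I; F →L[ℝ] ℝ, DualBundle V⟯) (s : Cₛ^∞⟮I; F, V⟯) (x : M) :
    pairing α s x = α x (s x) := rfl

/-- A smooth function as a smooth section of the trivial line bundle. -/
theorem contMDiff_trivial {g : M → ℝ} (hg : ContMDiff I 𝓘(ℝ, ℝ) ∞ g) :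
    ContMDiff I (I.prod 𝓘(ℝ, ℝ)) ∞ (fun x => TotalSpace.mk' ℝ (E := fun _ : M => ℝ) x (g x)) :=
  fun x => contMDiffAt_totalSpace.2 ⟨contMDiffAt_id, hg x⟩

variable [IsManifold I ∞ M]

/-- The derivative `X.f` of a smooth function along a vector field. -/
def vectorDeriv (X : Cₛ^∞⟮I; E, (TangentSpace I : M → Type _)⟯) (f : C^∞⟮I, M; ℝ⟯) : C^∞⟮I, M; ℝ⟯ :=
  ⟨fun x => mvfderiv I f x (X x), by
    have h1 := f.contMDiff.contMDiff_tangentMap (m := ∞) (by simp)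
    have h2 := h1.comp X.contMDiff
    exact (contMDiff_snd_tangentBundle_modelSpace ℝ 𝓘(ℝ, ℝ)).comp h2⟩

theorem vectorDeriv_apply (X : Cₛ^∞⟮I; E, (TangentSpace I : M → Type _)⟯) (f : C^∞⟮I, M; ℝ⟯)
   (x : M) : vectorDeriv X f x = mvfderiv I f x (X x) := rfl

end Basic

section Repr
variable {E : Type*} [NormedAddCommGroup E] [NormedSpace ℝ E] [FiniteDimensional ℝ E]
  {H : Type*} [TopologicalSpace H] {I : ModelWithCorners ℝ E H}
  {M : Type*} [TopologicalSpace M] [ChartedSpace H M] [IsManifold I ∞ M] [T2Space M]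
  {F : Type*} [NormedAddCommGroup F] [NormedSpace ℝ F] [FiniteDimensional ℝ F]
  {V : M → Type*} [TopologicalSpace (TotalSpace F V)]
  [∀ x, AddCommGroup (V x)] [∀ x, Module ℝ (V x)] [∀ x, TopologicalSpace (V x)]
  [FiberBundle F V] [VectorBundle ℝ F V] [ContMDiffVectorBundle ∞ F V I]
  {F' : Type*} [NormedAddCommGroup F'] [NormedSpace ℝ F']
  {W : M → Type*} [TopologicalSpace (TotalSpace F' W)]
  [∀ x, AddCommGroup (W x)] [∀ x, Module ℝ (W x)] [∀ x, TopologicalSpace (W x)]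
  [∀ x, IsTopologicalAddGroup (W x)] [∀ x, ContinuousSMul ℝ (W x)]
  [FiberBundle F' W] [VectorBundle ℝ F' W] 

/-- Smooth cut-off functions. -/
theorem exists_cutoff (x₀ : M) {U : Set M} (hU : U ∈ 𝓝 x₀) :
    ∃ ψ : C^∞⟮I, M; ℝ⟯, (∀ᶠ x in 𝓝 x₀, ψ x = 1) ∧ tsupport ψ ⊆ U := by
  obtain ⟨f, -, hf⟩ := (SmoothBumpFunction.nhds_basis_tsupport (I := I) x₀).mem_iff.1 hU
  exact ⟨⟨f, f.contMDiff⟩, f.eventuallyEq_one, hf⟩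

/-- A local frame, cut off to global sections, together with its coefficient functionals. -/
theorem exists_frame (x₀ : M) : ∃ (ψ : C^∞⟮I, M; ℝ⟯)
    (σ : Module.Free.ChooseBasisIndex ℝ F → Cₛ^∞⟮I; F, V⟯),
    (∀ᶠ x in 𝓝 x₀, ψ x = 1) ∧
    (∀ i, ∀ᶠ x in 𝓝 x₀, σ i x = (trivializationAt F V x₀).localFrame
      (Module.Free.chooseBasis ℝ F) i x) ∧
    (∀ (i) (s : Cₛ^∞⟮I; F, V⟯), ∃ c : C^∞⟮I, M; ℝ⟯, ∀ x, c x = ψ x *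
      (trivializationAt F V x₀).localFrameCoeff I (Module.Free.chooseBasis ℝ F) i x (s x)) ∧
    (∀ (s : Cₛ^∞⟮I; F, V⟯) (x : M), (ψ x * ψ x) • s x = ∑ i, (ψ x *
      (trivializationAt F V x₀).localFrameCoeff I (Module.Free.chooseBasis ℝ F) i x (s x)) •
        σ i x) := by
  set b := Module.Free.chooseBasis ℝ F
  set e := trivializationAt F V x₀
  have hx₀ : x₀ ∈ e.baseSet := FiberBundle.mem_baseSet_trivializationAt F V x₀
  obtain ⟨ψ, h1, h2⟩ := exists_cutoff (I := I) x₀ (e.open_baseSet.mem_nhds hx₀)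
  have hψ : ∀ x, x ∉ e.baseSet → ψ x = 0 := fun x hx =>
    image_eq_zero_of_notMem_tsupport (fun h => hx (h2 h))
  refine ⟨ψ, fun i => ⟨fun x => ψ x • e.localFrame b i x,
    ContMDiffOn.smul_section_of_tsupport ψ.contMDiff.contMDiffOn e.open_baseSet h2
      (e.contMDiffOn_localFrame_baseSet ∞ b i)⟩, h1, ?_, ?_, ?_⟩
  · intro i
    filter_upwards [h1] with x hx
    change ψ x • e.localFrame b i x = _
    rw [hx, one_smul]
  · intro i s
    refine ⟨⟨fun x => ψ x * e.localFrameCoeff I b i x (s x), ?_⟩, fun x => rfl⟩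
    have h3 : ContMDiffOn I 𝓘(ℝ, ℝ) ∞ (fun x => ψ x * e.localFrameCoeff I b i x (s x)) e.baseSet :=
      ψ.contMDiff.contMDiffOn.mul
        (contMDiffOn_baseSet_localFrameCoeff (k := ∞) b s.contMDiff.contMDiffOn i)
    refine contMDiff_of_contMDiffOn_union_of_isOpen h3
      (t := (tsupport ψ)ᶜ) ?_ ?_ e.open_baseSet (isClosed_tsupport ψ).isOpen_compl
    · refine (contMDiffOn_const (c := (0 : ℝ))).congr fun x hx => ?_
      rw [image_eq_zero_of_notMem_tsupport hx, zero_mul]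
    · exact Set.compl_subset_iff_union.mp (Set.compl_subset_compl.mpr h2)
  · intro s x
    by_cases hx : x ∈ e.baseSet
    · conv_lhs => rw [e.eq_sum_localFrameCoeff_smul (I := I) (b := b) (s := s) hx, Finset.smul_sum]
      refine Finset.sum_congr rfl fun i _ => ?_
      change _ = _ • (ψ x • e.localFrame b i x)
      rw [smul_smul, smul_smul]
      congr 1
      ring
    · simp [hψ x hx]

/-- A functional on sections which is linear over smooth functions acts pointwise. -/
theorem eq_of_apply_eq (L : Cₛ^∞⟮I; F, V⟯ → C^∞⟮I, M; ℝ⟯)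
    (hadd : ∀ s t, L (s + t) = L s + L t) (hsmul : ∀ (f : C^∞⟮I, M; ℝ⟯) s, L (f • s) = f * L s)
    {s t : Cₛ^∞⟮I; F, V⟯} {x₀ : M} (h : s x₀ = t x₀) : L s x₀ = L t x₀ := by
  obtain ⟨ψ, σ, h1, -, h3, h4⟩ := exists_frame (I := I) (F := F) (V := V) x₀
  have hψ : ψ x₀ = 1 := h1.self_of_nhds
  choose c hc using h3
  let L' : Cₛ^∞⟮I; F, V⟯ →+ C^∞⟮I, M; ℝ⟯ := AddMonoidHom.mk' L hadd
  have key : ∀ s, L s x₀ = ∑ i, c i s x₀ * L (σ i) x₀ := by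
    intro s
    have e1 : (ψ * ψ) • s = ∑ i, c i s • σ i := by
      ext x
      have := h4 s x
      simp only [← hc] at this
      rw [smul_section_apply]
      refine this.trans ?_
      change _ = ContMDiffSection.coeAddHom I F ∞ V _ x
      rw [map_sum, Finset.sum_apply]
      rfl
    have e2 := congrArg L' e1
    rw [map_sum] at e2
    have e3 : (ψ * ψ) * L s = ∑ i, c i s * L (σ i) := by
      rw [← hsmul]
      refine e2.trans (Finset.sum_congr rfl fun i _ => hsmul _ _)
    have e4 := congrArg (fun f : C^∞⟮I, M; ℝ⟯ => f x₀) e3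
    simp only [ContMDiffMap.coe_mul, Pi.mul_apply, hψ, one_mul] at e4
    rw [e4]
    change ContMDiffMap.coeFnAddMonoidHom _ x₀ = _
    rw [map_sum, Finset.sum_apply]
    rfl
  rw [key, key]
  refine Finset.sum_congr rfl fun i _ => ?_
  rw [hc, hc, h]

/-- Every vector is the value of a smooth section. -/
theorem exists_section_eq (x₀ : M) (v : V x₀) : ∃ s : Cₛ^∞⟮I; F, V⟯, s x₀ = v := by
  obtain ⟨ψ, σ, -, h2, -, -⟩ := exists_frame (I := I) (F := F) (V := V) x₀
  have hx₀ := FiberBundle.mem_baseSet_trivializationAt F V x₀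
  set b := (trivializationAt F V x₀).basisAt (Module.Free.chooseBasis ℝ F) hx₀
  refine ⟨∑ i, b.repr v i • σ i, ?_⟩
  change ContMDiffSection.coeAddHom I F ∞ V _ x₀ = _
  rw [map_sum, Finset.sum_apply]
  conv_rhs => rw [← b.sum_repr v]
  refine Finset.sum_congr rfl fun i _ => ?_
  change b.repr v i • σ i x₀ = _
  rw [(h2 i).self_of_nhds, Bundle.Trivialization.localFrame_apply_of_mem_baseSet _ _ hx₀]

/-- A field of linear maps is smooth as soon as it maps smooth sections to smooth sections. -/
theorem contMDiff_hom (Φ : ∀ x, V x →L[ℝ] W x)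
    (h : ∀ s : Cₛ^∞⟮I; F, V⟯, ContMDiff I (I.prod 𝓘(ℝ, F')) ∞
      (fun x => TotalSpace.mk' F' x (Φ x (s x)))) :
    ContMDiff I (I.prod 𝓘(ℝ, F →L[ℝ] F')) ∞
      (fun x => TotalSpace.mk' (F →L[ℝ] F') (E := fun x => V x →L[ℝ] W x) x (Φ x)) := by
  intro x₀
  obtain ⟨ψ, σ, -, h2, -, -⟩ := exists_frame (I := I) (F := F) (V := V) x₀
  rw [contMDiffAt_hom_bundle]
  refine ⟨contMDiffAt_id, ?_⟩
  set b := Module.Free.chooseBasis ℝ F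
  set e := trivializationAt F V x₀ with he
  set e' := trivializationAt F' W x₀ with he'
  have hx : x₀ ∈ e.baseSet := FiberBundle.mem_baseSet_trivializationAt F V x₀
  have hx' : x₀ ∈ e'.baseSet := FiberBundle.mem_baseSet_trivializationAt F' W x₀
  have hs : ∀ i, ContMDiffAt I 𝓘(ℝ, F') ∞ (fun x => (e' ⟨x, Φ x (σ i x)⟩).2) x₀ := fun i =>
    (contMDiffAt_section x₀).1 (h (σ i) x₀)
  let cd : Module.Free.ChooseBasisIndex ℝ F → (F →L[ℝ] ℝ) := fun i =>
    LinearMap.toContinuousLinearMap (b.coord i)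
  have hsum : ContMDiffAt I 𝓘(ℝ, F →L[ℝ] F') ∞ (fun x => ∑ i,
      ContinuousLinearMap.smulRightL ℝ F F' (cd i) (e' ⟨x, Φ x (σ i x)⟩).2) x₀ := by
    refine contMDiffAt_finsetSum fun i _ => ?_
    exact (ContinuousLinearMap.contMDiff _).contMDiffAt.comp x₀ (hs i)
  refine hsum.congr_of_eventuallyEq ?_
  filter_upwards [e.open_baseSet.mem_nhds hx, e'.open_baseSet.mem_nhds hx',
    Filter.eventually_all.2 h2] with x h1 h1' hσ
  refine ContinuousLinearMap.ext fun v => ?_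
  rw [ContinuousLinearMap.inCoordinates_eq h1 h1', _root_.sum_apply]
  conv_lhs => rw [← b.sum_repr v]
  rw [map_sum]
  refine Finset.sum_congr rfl fun i _ => ?_
  rw [hσ i, Bundle.Trivialization.localFrame_apply_of_mem_baseSet _ _ h1]
  simp [cd, Bundle.Trivialization.basisAt]
  rfl


/-- The pairing is nondegenerate on sections of the dual bundle. -/
theorem eq_of_pairing_left {α β : Cₛ^∞⟮I; F →L[ℝ] ℝ, DualBundle V⟯}
    (h : ∀ s, pairing α s = pairing β s) : α = β := by
  ext x v
  obtain ⟨s, rfl⟩ := exists_section_eq (I := I) (F := F) x v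
  exact congrArg (fun f : C^∞⟮I, M; ℝ⟯ => f x) (h s)

variable [∀ x, IsTopologicalAddGroup (V x)] [∀ x, ContinuousSMul ℝ (V x)]

/-- A functional on `Γ(V)` which is linear over functions is the pairing with a section of `V*`. -/
theorem exists_dual_section (L : Cₛ^∞⟮I; F, V⟯ → C^∞⟮I, M; ℝ⟯)
    (hadd : ∀ s t, L (s + t) = L s + L t) (hsmul : ∀ (f : C^∞⟮I, M; ℝ⟯) s, L (f • s) = f * L s) :
    ∃ α : Cₛ^∞⟮I; F →L[ℝ] ℝ, DualBundle V⟯, ∀ s, pairing α s = L s := by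
  have hfin : ∀ x, FiniteDimensional ℝ (V x) := fun x => VectorBundle.finiteDimensional ℝ F V x
  have hT2 : ∀ x, T2Space (V x) := fun x => FiberBundle.t2Space F V x
  choose ext hext using exists_section_eq (I := I) (F := F) (V := V)
  let α : ∀ x, V x →L[ℝ] ℝ := fun x => LinearMap.toContinuousLinearMap
    { toFun := fun v => L (ext x v) x
      map_add' := fun v w => by
        rw [← Pi.add_apply, ← ContMDiffMap.coe_add, ← hadd]
        exact eq_of_apply_eq L hadd hsmul (by simp [hext])
      map_smul' := fun c v => by
        have h1 : L (ext x (c • v)) x =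
            L ((ContMDiffMap.const c : C^∞⟮I, M; ℝ⟯) • ext x v) x :=
          eq_of_apply_eq L hadd hsmul (by rw [smul_section_apply, hext, hext]; rfl)
        rw [h1, hsmul]
        rfl }
  have hα : ∀ (s : Cₛ^∞⟮I; F, V⟯) x, α x (s x) = L s x := fun s x =>
    eq_of_apply_eq L hadd hsmul (hext x (s x))
  refine ⟨⟨α, contMDiff_hom (W := fun _ => ℝ) α fun s => ?_⟩, fun s => ?_⟩
  · simp only [hα]
    exact contMDiff_trivial (L s).contMDiff
  · ext x
    exact hα s x

/-- A field of vectors is smooth as soon as its pairings with smooth dual sections are smooth. -/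
theorem contMDiff_of_pairing (v : ∀ x, V x)
    (h : ∀ α : Cₛ^∞⟮I; F →L[ℝ] ℝ, DualBundle V⟯, ContMDiff I 𝓘(ℝ, ℝ) ∞ (fun x => α x (v x))) :
    ContMDiff I (I.prod 𝓘(ℝ, F)) ∞ (fun x => TotalSpace.mk' F x (v x)) := by
  have hfin : ∀ x, FiniteDimensional ℝ (V x) := fun x => VectorBundle.finiteDimensional ℝ F V x
  have hT2 : ∀ x, T2Space (V x) := fun x => FiberBundle.t2Space F V x
  intro x₀
  obtain ⟨ψ, σ, h1, -, h3, -⟩ := exists_frame (I := I) (F := F) (V := V) x₀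
  have hx₀ := FiberBundle.mem_baseSet_trivializationAt F V x₀
  rw [contMDiffAt_iff_localFrameCoeff (Module.Free.chooseBasis ℝ F) hx₀]
  intro i
  let α : Cₛ^∞⟮I; F →L[ℝ] ℝ, DualBundle V⟯ :=
    ⟨fun x => ψ x • LinearMap.toContinuousLinearMap ((trivializationAt F V x₀).localFrameCoeff I
        (Module.Free.chooseBasis ℝ F) i x), contMDiff_hom (W := fun _ => ℝ) _ fun s => by
      obtain ⟨c, hc⟩ := h3 i s
      refine contMDiff_trivial (g := fun x => ψ x * (trivializationAt F V x₀).localFrameCoeff I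
        (Module.Free.chooseBasis ℝ F) i x (s x)) ?_
      simp only [← hc]
      exact c.contMDiff⟩
  refine (h α x₀).congr_of_eventuallyEq ?_
  filter_upwards [h1] with x hx
  change _ = ψ x * _
  rw [hx, one_mul]
  rfl

/-- A functional on `Γ(V*)` which is linear over functions is the pairing with a section of `V`. -/
theorem exists_predual_section (L : Cₛ^∞⟮I; F →L[ℝ] ℝ, DualBundle V⟯ → C^∞⟮I, M; ℝ⟯)
    (hadd : ∀ s t, L (s + t) = L s + L t) (hsmul : ∀ (f : C^∞⟮I, M; ℝ⟯) s, L (f • s) = f * L s) :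
    ∃ s : Cₛ^∞⟮I; F, V⟯, ∀ α, pairing α s = L α := by
  have hfin : ∀ x, FiniteDimensional ℝ (V x) := fun x => VectorBundle.finiteDimensional ℝ F V x
  have hT2 : ∀ x, T2Space (V x) := fun x => FiberBundle.t2Space F V x
  obtain ⟨Λ, hΛ⟩ := exists_dual_section (V := DualBundle V) L hadd hsmul
  have hv : ∀ x, ∃ v : V x, ∀ φ : V x →L[ℝ] ℝ, φ v = Λ x φ := by
    intro x
    obtain ⟨v, hv⟩ := (Module.evalEquiv ℝ (V x)).surjective
      ((Λ x).toLinearMap ∘ₗ (LinearMap.toContinuousLinearMap (𝕜 := ℝ) (E := V x)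
        (F' := ℝ)).toLinearMap)
    refine ⟨v, fun φ => ?_⟩
    have := LinearMap.congr_fun hv (φ : V x →ₗ[ℝ] ℝ)
    exact this
  choose v hv using hv
  have hvL : ∀ (α : Cₛ^∞⟮I; F →L[ℝ] ℝ, DualBundle V⟯) x, α x (v x) = L α x := fun α x => by
    rw [hv, ← hΛ α]
    rfl
  refine ⟨⟨v, contMDiff_of_pairing v fun α => ?_⟩, fun α => ?_⟩
  · simp only [hvL]
    exact (L α).contMDiff
  · ext x
    exact hvL α x

/-- The pairing is nondegenerate on sections of the bundle. -/
theorem eq_of_pairing_right {s t : Cₛ^∞⟮I; F, V⟯}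
    (h : ∀ α : Cₛ^∞⟮I; F →L[ℝ] ℝ, DualBundle V⟯, pairing α s = pairing α t) : s = t := by
  have hfin : ∀ x, FiniteDimensional ℝ (V x) := fun x => VectorBundle.finiteDimensional ℝ F V x
  have hT2 : ∀ x, T2Space (V x) := fun x => FiberBundle.t2Space F V x
  ext x
  refine sub_eq_zero.1 ((Module.forall_dual_apply_eq_zero_iff ℝ _).1 fun φ => ?_)
  obtain ⟨α, hα⟩ := exists_section_eq (I := I) (F := F →L[ℝ] ℝ) (V := DualBundle V) x
    (LinearMap.toContinuousLinearMap φ)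
  have := congrArg (fun f : C^∞⟮I, M; ℝ⟯ => f x) (h α)
  simpa [pairing_apply, hα, sub_eq_zero] using this

end Repr

section Algebroid
variable {E : Type*} [NormedAddCommGroup E] [NormedSpace ℝ E]
  {H : Type*} [TopologicalSpace H] {I : ModelWithCorners ℝ E H}
  {M : Type*} [TopologicalSpace M] [ChartedSpace H M] [IsManifold I ∞ M]
  {F : Type*} [NormedAddCommGroup F] [NormedSpace ℝ F]
  {V : M → Type*} [TopologicalSpace (TotalSpace F V)]
  [∀ x, AddCommGroup (V x)] [∀ x, Module ℝ (V x)] [∀ x, TopologicalSpace (V x)]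
  [FiberBundle F V] [VectorBundle ℝ F V]

variable (I F V) in
/-- An anchor on the vector bundle `V` over `M`, i.e. a smooth bundle homomorphism `V → TM`. -/
abbrev Anchor : Type _ := Cₛ^∞⟮I; F →L[ℝ] E, fun x : M => V x →L[ℝ] TangentSpace I x⟯

/-- The function `ρ(a).f`. -/
def Anchor.deriv (ρ : Anchor I F V) (a : Cₛ^∞⟮I; F, V⟯) (f : C^∞⟮I, M; ℝ⟯) : C^∞⟮I, M; ℝ⟯ :=
  vectorDeriv (applySection ρ a) f

/-- A right-anchored product on the anchored vector bundle `(V, M, ρ)`: an `ℝ`-bilinear product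
on smooth sections, linear over functions in the first argument and satisfying the Leibniz rule
in the second one. -/
structure RightAnchoredProduct (ρ : Anchor I F V) where
  /-- The underlying bilinear map `(a, b) ↦ T_a b`. -/
  prod : Cₛ^∞⟮I; F, V⟯ →ₗ[ℝ] Cₛ^∞⟮I; F, V⟯ →ₗ[ℝ] Cₛ^∞⟮I; F, V⟯
  smul_left : ∀ (f : C^∞⟮I, M; ℝ⟯) a b, prod (f • a) b = f • prod a b
  leibniz : ∀ (f : C^∞⟮I, M; ℝ⟯) a b, prod a (f • b) = f • prod a b + (ρ.deriv a f) • b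

/-- The curvature `R(a, b)c = [T_a, T_b]c - T_{[a, b]}c`, `[a, b] = T_a b - T_b a`, of a product
`T` on an additive group. -/
def curvature {G : Type*} [AddCommGroup G] (T : G → G → G) (a b c : G) : G :=
  T a (T b c) - T b (T a c) - T (T a b - T b a) c

namespace RightAnchoredProduct

/-- `(V, M, ρ, T)` is a left symmetric algebroid if the curvature of `T` vanishes. -/
def IsLeftSymmetric {ρ : Anchor I F V} (T : RightAnchoredProduct ρ) : Prop :=
  ∀ a b c : Cₛ^∞⟮I; F, V⟯, curvature (fun s t => T.prod s t) a b c = 0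

/-- The bracket `[a, b]_T = T_a b - T_b a`. -/
def bracket {ρ : Anchor I F V} (T : RightAnchoredProduct ρ) (a b : Cₛ^∞⟮I; F, V⟯) :
    Cₛ^∞⟮I; F, V⟯ := T.prod a b - T.prod b a

end RightAnchoredProduct

theorem Anchor.deriv_apply (ρ : Anchor I F V) (a : Cₛ^∞⟮I; F, V⟯) (f : C^∞⟮I, M; ℝ⟯) (x : M) :
    ρ.deriv a f x = mvfderiv I f x (ρ x (a x)) := rfl

theorem Anchor.deriv_add (ρ : Anchor I F V) (a : Cₛ^∞⟮I; F, V⟯) (f g : C^∞⟮I, M; ℝ⟯) :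
    ρ.deriv a (f + g) = ρ.deriv a f + ρ.deriv a g := by
  ext x
  rw [ContMDiffMap.coe_add, Pi.add_apply, ρ.deriv_apply, ρ.deriv_apply, ρ.deriv_apply,
    ContMDiffMap.coe_add, mvfderiv_add f.mdifferentiableAt g.mdifferentiableAt]
  rfl

theorem Anchor.deriv_mul (ρ : Anchor I F V) (a : Cₛ^∞⟮I; F, V⟯) (f g : C^∞⟮I, M; ℝ⟯) :
    ρ.deriv a (f * g) = f * ρ.deriv a g + ρ.deriv a f * g := by
  ext x
  rw [ContMDiffMap.coe_add, Pi.add_apply, ContMDiffMap.coe_mul, ContMDiffMap.coe_mul, Pi.mul_apply,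
    Pi.mul_apply, ρ.deriv_apply, ρ.deriv_apply, ρ.deriv_apply, ContMDiffMap.coe_mul,
    mvfderiv_mul f.mdifferentiableAt g.mdifferentiableAt]
  simp [mul_comm]

theorem Anchor.deriv_const (ρ : Anchor I F V) (a : Cₛ^∞⟮I; F, V⟯) (c : ℝ) :
    ρ.deriv a (ContMDiffMap.const c) = 0 := by
  ext x
  rw [ρ.deriv_apply]
  change mvfderiv I (fun _ : M => c) x _ = 0
  rw [mvfderiv_const]
  rfl

theorem Anchor.deriv_add_left (ρ : Anchor I F V) (a b : Cₛ^∞⟮I; F, V⟯) (f : C^∞⟮I, M; ℝ⟯) :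
    ρ.deriv (a + b) f = ρ.deriv a f + ρ.deriv b f := by
  ext x
  rw [ContMDiffMap.coe_add, Pi.add_apply, ρ.deriv_apply, ρ.deriv_apply, ρ.deriv_apply,
    ContMDiffSection.coe_add, Pi.add_apply, map_add, map_add]

theorem Anchor.deriv_smul_left (ρ : Anchor I F V) (g : C^∞⟮I, M; ℝ⟯) (a : Cₛ^∞⟮I; F, V⟯)
    (f : C^∞⟮I, M; ℝ⟯) : ρ.deriv (g • a) f = g * ρ.deriv a f := by
  ext x
  rw [ContMDiffMap.coe_mul, Pi.mul_apply, ρ.deriv_apply, ρ.deriv_apply, smul_section_apply,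
    map_smul, map_smul, smul_eq_mul]

end Algebroid

section Pairing
variable {E : Type*} [NormedAddCommGroup E] [NormedSpace ℝ E]
  {H : Type*} [TopologicalSpace H] {I : ModelWithCorners ℝ E H}
  {M : Type*} [TopologicalSpace M] [ChartedSpace H M]
  {F : Type*} [NormedAddCommGroup F] [NormedSpace ℝ F]
  {V : M → Type*} [TopologicalSpace (TotalSpace F V)]
  [∀ x, AddCommGroup (V x)] [∀ x, Module ℝ (V x)] [∀ x, TopologicalSpace (V x)]
  [FiberBundle F V] [VectorBundle ℝ F V]
  (α β : Cₛ^∞⟮I; F →L[ℝ] ℝ, DualBundle V⟯) (s t : Cₛ^∞⟮I; F, V⟯) (f : C^∞⟮I, M; ℝ⟯)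

theorem pairing_add_left : pairing (α + β) s = pairing α s + pairing β s := rfl

theorem pairing_add_right : pairing α (s + t) = pairing α s + pairing α t :=
  ContMDiffMap.ext fun x => map_add (α x) (s x) (t x)

theorem pairing_sub_left : pairing (α - β) s = pairing α s - pairing β s := rfl

theorem pairing_sub_right : pairing α (s - t) = pairing α s - pairing α t :=
  ContMDiffMap.ext fun x => map_sub (α x) (s x) (t x)

theorem pairing_smul_left : pairing (f • α) s = f * pairing α s := rfl

theorem pairing_smul_right : pairing α (f • s) = f * pairing α s :=
  ContMDiffMap.ext fun x => map_smul (α x) (f x) (s x)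

end Pairing

section Tensor
variable {E : Type*} [NormedAddCommGroup E] [NormedSpace ℝ E]
  {H : Type*} [TopologicalSpace H] {I : ModelWithCorners ℝ E H}
  {M : Type*} [TopologicalSpace M] [ChartedSpace H M]
  {F : Type*} [NormedAddCommGroup F] [NormedSpace ℝ F]
  {V : M → Type*} [TopologicalSpace (TotalSpace F V)]
  [∀ x, AddCommGroup (V x)] [∀ x, Module ℝ (V x)] [∀ x, TopologicalSpace (V x)]
  [∀ x, IsTopologicalAddGroup (V x)] [∀ x, ContinuousSMul ℝ (V x)]
  [FiberBundle F V] [VectorBundle ℝ F V]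

/-- The contraction `V ⊗ V → Hom(V*, V)`, `v ⊗ w ↦ (φ ↦ φ(v) w)`. -/
def contract (U : Type*) [AddCommGroup U] [Module ℝ U] [TopologicalSpace U]
    [IsTopologicalAddGroup U] [ContinuousSMul ℝ U] :
    U ⊗[ℝ] U →ₗ[ℝ] ((U →L[ℝ] ℝ) →L[ℝ] U) :=
  TensorProduct.lift (LinearMap.mk₂ ℝ
    (fun v w => ContinuousLinearMap.smulRight
      (⟨⟨⟨fun φ => φ v, fun _ _ => rfl⟩, fun _ _ => rfl⟩, continuous_eval_const v⟩ :
        (U →L[ℝ] ℝ) →L[ℝ] ℝ) w)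
    (fun v v' w => by ext φ; simp [add_smul])
    (fun c v w => by ext φ; simp [mul_smul])
    (fun v w w' => by ext φ; simp)
    (fun c v w => ContinuousLinearMap.ext fun φ => smul_comm (φ v) c w))

theorem contract_tmul {U : Type*} [AddCommGroup U] [Module ℝ U] [TopologicalSpace U]
    [IsTopologicalAddGroup U] [ContinuousSMul ℝ U] (v w : U) (φ : U →L[ℝ] ℝ) :
    contract U (v ⊗ₜ w) φ = φ v • w := by
  simp [contract]

theorem contract_comm {U : Type*} [AddCommGroup U] [Module ℝ U] [TopologicalSpace U]
    [IsTopologicalAddGroup U] [ContinuousSMul ℝ U] (r : U ⊗[ℝ] U) (φ ψ : U →L[ℝ] ℝ) :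
    ψ (contract U (TensorProduct.comm ℝ U U r) φ) = φ (contract U r ψ) := by
  induction r with
  | zero => simp
  | tmul v w => simp [contract_tmul, mul_comm]
  | add a b ha hb => simp [ha, hb]

variable (I F V) in
/-- A smooth section of `V ⊗ V`; the smooth structure of this bundle is the one for which the
canonical fibrewise isomorphism `V ⊗ V ≅ Hom(V*, V)` is smooth. -/
structure TensorSection where
  /-- The value at a point. -/
  toFun : ∀ x, V x ⊗[ℝ] V x
  smooth : ContMDiff I (I.prod 𝓘(ℝ, (F →L[ℝ] ℝ) →L[ℝ] F)) ∞ (fun x =>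
    TotalSpace.mk' ((F →L[ℝ] ℝ) →L[ℝ] F) (E := fun x => DualBundle V x →L[ℝ] V x) x
      (contract (V x) (toFun x)))

namespace TensorSection

/-- The bundle homomorphism `r_# : V* → V`, `β(r_#(α)) = r(α, β)`. -/
def sharpHom (r : TensorSection I F V) :
    Cₛ^∞⟮I; (F →L[ℝ] ℝ) →L[ℝ] F, fun x => DualBundle V x →L[ℝ] V x⟯ :=
  ⟨fun x => contract (V x) (r.toFun x), r.smooth⟩

/-- The map `r_#` on sections. -/
def sharp (r : TensorSection I F V) (α : Cₛ^∞⟮I; F →L[ℝ] ℝ, DualBundle V⟯) : Cₛ^∞⟮I; F, V⟯ :=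
  applySection r.sharpHom α

/-- The function `r(α, β)`. -/
def form (r : TensorSection I F V) (α β : Cₛ^∞⟮I; F →L[ℝ] ℝ, DualBundle V⟯) : C^∞⟮I, M; ℝ⟯ :=
  pairing β (r.sharp α)

variable (r : TensorSection I F V)

theorem form_add_left (α α' β : Cₛ^∞⟮I; F →L[ℝ] ℝ, DualBundle V⟯) :
    r.form (α + α') β = r.form α β + r.form α' β := by
  ext x
  change β x (r.sharpHom x (α x + α' x)) = β x (r.sharpHom x (α x)) + β x (r.sharpHom x (α' x))
  rw [map_add, map_add]

theorem form_add_right (α β β' : Cₛ^∞⟮I; F →L[ℝ] ℝ, DualBundle V⟯) :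
    r.form α (β + β') = r.form α β + r.form α β' := rfl

theorem form_smul_left (f : C^∞⟮I, M; ℝ⟯) (α β : Cₛ^∞⟮I; F →L[ℝ] ℝ, DualBundle V⟯) :
    r.form (f • α) β = f * r.form α β := by
  ext x
  change β x (r.sharpHom x (f x • α x)) = f x * β x (r.sharpHom x (α x))
  rw [map_smul, map_smul, smul_eq_mul]

theorem form_smul_right (f : C^∞⟮I, M; ℝ⟯) (α β : Cₛ^∞⟮I; F →L[ℝ] ℝ, DualBundle V⟯) :
    r.form α (f • β) = f * r.form α β := rfl

theorem sharp_add (α β : Cₛ^∞⟮I; F →L[ℝ] ℝ, DualBundle V⟯) :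
    r.sharp (α + β) = r.sharp α + r.sharp β :=
  ContMDiffSection.ext fun x => map_add (r.sharpHom x) (α x) (β x)

theorem sharp_smul (f : C^∞⟮I, M; ℝ⟯) (α : Cₛ^∞⟮I; F →L[ℝ] ℝ, DualBundle V⟯) :
    r.sharp (f • α) = f • r.sharp α :=
  ContMDiffSection.ext fun x => map_smul (r.sharpHom x) (f x) (α x)

end TensorSection

end Tensor

section Dual
variable {E : Type*} [NormedAddCommGroup E] [NormedSpace ℝ E] [FiniteDimensional ℝ E]
  {H : Type*} [TopologicalSpace H] {I : ModelWithCorners ℝ E H}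
  {M : Type*} [TopologicalSpace M] [ChartedSpace H M] [IsManifold I ∞ M] [T2Space M]
  {F : Type*} [NormedAddCommGroup F] [NormedSpace ℝ F] [FiniteDimensional ℝ F]
  {V : M → Type*} [TopologicalSpace (TotalSpace F V)]
  [∀ x, AddCommGroup (V x)] [∀ x, Module ℝ (V x)] [∀ x, TopologicalSpace (V x)]
  [∀ x, IsTopologicalAddGroup (V x)] [∀ x, ContinuousSMul ℝ (V x)]
  [FiberBundle F V] [VectorBundle ℝ F V] [ContMDiffVectorBundle ∞ F V I]

namespace RightAnchoredProduct

theorem exists_dual {ρ : Anchor I F V} (T : RightAnchoredProduct ρ) (a : Cₛ^∞⟮I; F, V⟯)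
    (α : Cₛ^∞⟮I; F →L[ℝ] ℝ, DualBundle V⟯) :
    ∃ β : Cₛ^∞⟮I; F →L[ℝ] ℝ, DualBundle V⟯, ∀ s, pairing β s =
      ρ.deriv a (pairing α s) - pairing α (T.prod a s) := by
  refine exists_dual_section _ (fun s t => ?_) (fun f s => ?_)
  · rw [map_add, pairing_add_right, pairing_add_right, ρ.deriv_add]
    ring
  · rw [T.leibniz, pairing_smul_right, pairing_add_right, pairing_smul_right, pairing_smul_right,
      ρ.deriv_mul]
    ring

/-- The dual `T*` of `T`, acting on sections of `V*`:
`≺T*_a α, s≻ = ρ(a).≺α, s≻ - ≺α, T_a s≻` for every section `s` of `V`. -/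
def dual {ρ : Anchor I F V} (T : RightAnchoredProduct ρ) (a : Cₛ^∞⟮I; F, V⟯)
    (α : Cₛ^∞⟮I; F →L[ℝ] ℝ, DualBundle V⟯) : Cₛ^∞⟮I; F →L[ℝ] ℝ, DualBundle V⟯ :=
  (T.exists_dual a α).choose

theorem pairing_dual {ρ : Anchor I F V} (T : RightAnchoredProduct ρ) (a : Cₛ^∞⟮I; F, V⟯)
    (α : Cₛ^∞⟮I; F →L[ℝ] ℝ, DualBundle V⟯) (s : Cₛ^∞⟮I; F, V⟯) :
    pairing (T.dual a α) s = ρ.deriv a (pairing α s) - pairing α (T.prod a s) :=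
  (T.exists_dual a α).choose_spec s

theorem exists_predual {ρ : Anchor I (F →L[ℝ] ℝ) (DualBundle V)} (T : RightAnchoredProduct ρ)
    (α : Cₛ^∞⟮I; F →L[ℝ] ℝ, DualBundle V⟯) (s : Cₛ^∞⟮I; F, V⟯) :
    ∃ t : Cₛ^∞⟮I; F, V⟯, ∀ β : Cₛ^∞⟮I; F →L[ℝ] ℝ, DualBundle V⟯, pairing β t =
      ρ.deriv α (pairing β s) - pairing (T.prod α β) s := by
  refine exists_predual_section _ (fun s t => ?_) (fun f s => ?_)
  · rw [map_add, pairing_add_left, pairing_add_left, ρ.deriv_add]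
    ring
  · rw [T.leibniz, pairing_smul_left, pairing_add_left, pairing_smul_left, pairing_smul_left,
      ρ.deriv_mul]
    ring

/-- The dual `T*` of a product `T` on the dual bundle `V*`, acting on sections of `V = V**`:
`≺β, T*_α s≻ = ρ(α).≺β, s≻ - ≺T_α β, s≻` for every section `β` of `V*`. -/
def predual {ρ : Anchor I (F →L[ℝ] ℝ) (DualBundle V)} (T : RightAnchoredProduct ρ)
    (α : Cₛ^∞⟮I; F →L[ℝ] ℝ, DualBundle V⟯) (s : Cₛ^∞⟮I; F, V⟯) : Cₛ^∞⟮I; F, V⟯ :=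
  (T.exists_predual α s).choose

theorem pairing_predual {ρ : Anchor I (F →L[ℝ] ℝ) (DualBundle V)} (T : RightAnchoredProduct ρ)
    (α β : Cₛ^∞⟮I; F →L[ℝ] ℝ, DualBundle V⟯) (s : Cₛ^∞⟮I; F, V⟯) :
    pairing β (T.predual α s) = ρ.deriv α (pairing β s) - pairing (T.prod α β) s :=
  (T.exists_predual α s).choose_spec β

/-- The extension `∇_{X+α}(Y+β) = S_X Y + T*_α Y + S*_X β + T_α β` of a product `S` on `V` and a
product `T` on `V*` to the phase space `V ⊕ V*`, whose space of sections is `Γ(V) × Γ(V*)`. -/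
def extension {ρ₀ : Anchor I F V} {ρ₁ : Anchor I (F →L[ℝ] ℝ) (DualBundle V)}
    (S : RightAnchoredProduct ρ₀) (T : RightAnchoredProduct ρ₁)
    (p q : Cₛ^∞⟮I; F, V⟯ × Cₛ^∞⟮I; F →L[ℝ] ℝ, DualBundle V⟯) :
    Cₛ^∞⟮I; F, V⟯ × Cₛ^∞⟮I; F →L[ℝ] ℝ, DualBundle V⟯ :=
  (S.prod p.1 q.1 + T.predual p.2 q.1, S.dual p.1 q.2 + T.prod p.2 q.2)

/-- Compatibility (Lie-extendibility) of two left symmetric algebroids on dual vector bundles: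
`R(X, α)Y = R(Y, α)X` and `R(α, X)β = R(β, X)α`, where `R` is the curvature of the extension to the
phase space. -/
def Compatible {ρ₀ : Anchor I F V} {ρ₁ : Anchor I (F →L[ℝ] ℝ) (DualBundle V)}
    (S : RightAnchoredProduct ρ₀) (T : RightAnchoredProduct ρ₁) : Prop :=
  (∀ (X Y : Cₛ^∞⟮I; F, V⟯) (α : Cₛ^∞⟮I; F →L[ℝ] ℝ, DualBundle V⟯),
    curvature (extension S T) (X, 0) (0, α) (Y, 0) =
      curvature (extension S T) (Y, 0) (0, α) (X, 0)) ∧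
  (∀ (α β : Cₛ^∞⟮I; F →L[ℝ] ℝ, DualBundle V⟯) (X : Cₛ^∞⟮I; F, V⟯),
    curvature (extension S T) (0, α) (X, 0) (0, β) =
      curvature (extension S T) (0, β) (X, 0) (0, α))

/-- The action of `S_X` on bilinear forms on `Γ(V*)`:
`(S_X B)(α, β) = ρ(X).B(α, β) - B(S*_X α, β) - B(α, S*_X β)`. -/
def formDeriv {ρ : Anchor I F V} (S : RightAnchoredProduct ρ) (X : Cₛ^∞⟮I; F, V⟯)
    (B : Cₛ^∞⟮I; F →L[ℝ] ℝ, DualBundle V⟯ → Cₛ^∞⟮I; F →L[ℝ] ℝ, DualBundle V⟯ → C^∞⟮I, M; ℝ⟯) :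
    Cₛ^∞⟮I; F →L[ℝ] ℝ, DualBundle V⟯ → Cₛ^∞⟮I; F →L[ℝ] ℝ, DualBundle V⟯ → C^∞⟮I, M; ℝ⟯ :=
  fun α β => ρ.deriv X (B α β) - B (S.dual X α) β - B α (S.dual X β)

/-- The second derivative `S²_{X,Y} B = S_X S_Y B - S_{S_X Y} B`. -/
def formDeriv₂ {ρ : Anchor I F V} (S : RightAnchoredProduct ρ) (X Y : Cₛ^∞⟮I; F, V⟯)
    (B : Cₛ^∞⟮I; F →L[ℝ] ℝ, DualBundle V⟯ → Cₛ^∞⟮I; F →L[ℝ] ℝ, DualBundle V⟯ → C^∞⟮I, M; ℝ⟯) :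
    Cₛ^∞⟮I; F →L[ℝ] ℝ, DualBundle V⟯ → Cₛ^∞⟮I; F →L[ℝ] ℝ, DualBundle V⟯ → C^∞⟮I, M; ℝ⟯ :=
  fun α β => S.formDeriv X (S.formDeriv Y B) α β - S.formDeriv (S.prod X Y) B α β

variable {ρ : Anchor I F V} (S : RightAnchoredProduct ρ)

theorem dual_add_left (X Y : Cₛ^∞⟮I; F, V⟯) (α : Cₛ^∞⟮I; F →L[ℝ] ℝ, DualBundle V⟯) :
    S.dual (X + Y) α = S.dual X α + S.dual Y α := by
  refine eq_of_pairing_left fun s => ?_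
  rw [pairing_add_left, pairing_dual, pairing_dual, pairing_dual, ρ.deriv_add_left, map_add,
    LinearMap.add_apply, pairing_add_right]
  ring

theorem dual_add_right (X : Cₛ^∞⟮I; F, V⟯) (α β : Cₛ^∞⟮I; F →L[ℝ] ℝ, DualBundle V⟯) :
    S.dual X (α + β) = S.dual X α + S.dual X β := by
  refine eq_of_pairing_left fun s => ?_
  rw [pairing_add_left, pairing_dual, pairing_dual, pairing_dual, pairing_add_left,
    pairing_add_left, ρ.deriv_add]
  ring

theorem dual_smul_left (f : C^∞⟮I, M; ℝ⟯) (X : Cₛ^∞⟮I; F, V⟯)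
    (α : Cₛ^∞⟮I; F →L[ℝ] ℝ, DualBundle V⟯) : S.dual (f • X) α = f • S.dual X α := by
  refine eq_of_pairing_left fun s => ?_
  rw [pairing_smul_left, pairing_dual, pairing_dual, ρ.deriv_smul_left, S.smul_left,
    pairing_smul_right]
  ring

theorem dual_leibniz (f : C^∞⟮I, M; ℝ⟯) (X : Cₛ^∞⟮I; F, V⟯)
    (α : Cₛ^∞⟮I; F →L[ℝ] ℝ, DualBundle V⟯) :
    S.dual X (f • α) = f • S.dual X α + ρ.deriv X f • α := by
  refine eq_of_pairing_left fun s => ?_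
  rw [pairing_add_left, pairing_smul_left, pairing_smul_left, pairing_dual, pairing_dual,
    pairing_smul_left, pairing_smul_left, ρ.deriv_mul]
  ring

end RightAnchoredProduct

namespace TensorSection

/-- The skew-symmetric part of `r`. -/
def skewPart (r : TensorSection I F V) : TensorSection I F V where
  toFun x := (1 / 2 : ℝ) • (r.toFun x - TensorProduct.comm ℝ (V x) (V x) (r.toFun x))
  smooth := contMDiff_hom (V := DualBundle V) (W := V) _ fun α => contMDiff_of_pairing _ fun β => by
    have h := ((1 / 2 : ℝ) • (r.form α β - r.form β α)).contMDiff
    refine h.congr fun x => ?_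
    simp only [map_smul, map_sub, _root_.smul_apply, _root_.sub_apply,
      contract_comm]
    rfl

/-- The symmetric part of `r`. -/
def symmPart (r : TensorSection I F V) : TensorSection I F V where
  toFun x := (1 / 2 : ℝ) • (r.toFun x + TensorProduct.comm ℝ (V x) (V x) (r.toFun x))
  smooth := contMDiff_hom (V := DualBundle V) (W := V) _ fun α => contMDiff_of_pairing _ fun β => by
    have h := ((1 / 2 : ℝ) • (r.form α β + r.form β α)).contMDiff
    refine h.congr fun x => ?_
    simp only [map_smul, map_add, _root_.smul_apply, _root_.add_apply,
      contract_comm]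
    rfl

theorem skewPart_add_symmPart (r : TensorSection I F V) (x : M) :
    r.skewPart.toFun x + r.symmPart.toFun x = r.toFun x := by
  simp only [skewPart, symmPart]
  module

/-- The anchor `ρ_r = ρ ∘ r_#` on `V*`. -/
def anchor (ρ : Anchor I F V) (r : TensorSection I F V) :
    Anchor I (F →L[ℝ] ℝ) (DualBundle V) :=
  ⟨fun x => ρ x ∘L r.sharpHom x, contMDiff_hom (V := DualBundle V) (W := TangentSpace I) _ fun α =>
    (applySection ρ (r.sharp α)).contMDiff⟩

theorem anchor_deriv (ρ : Anchor I F V) (r : TensorSection I F V)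
    (α : Cₛ^∞⟮I; F →L[ℝ] ℝ, DualBundle V⟯) (f : C^∞⟮I, M; ℝ⟯) :
    (r.anchor ρ).deriv α f = ρ.deriv (r.sharp α) f := rfl

end TensorSection

namespace RightAnchoredProduct

variable {ρ : Anchor I F V} (S : RightAnchoredProduct ρ) (r : TensorSection I F V)

theorem exists_ofTensor (α β : Cₛ^∞⟮I; F →L[ℝ] ℝ, DualBundle V⟯) :
    ∃ γ : Cₛ^∞⟮I; F →L[ℝ] ℝ, DualBundle V⟯, ∀ X, pairing γ X =
      S.formDeriv X r.form α β + pairing (S.dual (r.sharp α) β) X := by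
  refine exists_dual_section _ (fun X Y => ?_) (fun f X => ?_)
  · simp only [formDeriv, ρ.deriv_add_left, dual_add_left, TensorSection.form_add_left, TensorSection.form_add_right,
      pairing_add_right]
    ring
  · simp only [formDeriv, ρ.deriv_smul_left, dual_smul_left, TensorSection.form_smul_left, TensorSection.form_smul_right,
      pairing_smul_right]
    ring

/-- The value `T_α β` of the product on `V*` defined by `r`:
`≺T_α β, X≻ = (S_X r)(α, β) + ≺S*_{r_#(α)} β, X≻` for every section `X` of `V`, where
`(S_X r)(α, β) = ρ(X).r(α, β) - r(S*_X α, β) - r(α, S*_X β)`. -/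
def ofTensorFun (α β : Cₛ^∞⟮I; F →L[ℝ] ℝ, DualBundle V⟯) :
    Cₛ^∞⟮I; F →L[ℝ] ℝ, DualBundle V⟯ := (S.exists_ofTensor r α β).choose

theorem pairing_ofTensorFun (α β : Cₛ^∞⟮I; F →L[ℝ] ℝ, DualBundle V⟯) (X : Cₛ^∞⟮I; F, V⟯) :
    pairing (S.ofTensorFun r α β) X =
      S.formDeriv X r.form α β + pairing (S.dual (r.sharp α) β) X :=
  (S.exists_ofTensor r α β).choose_spec X

theorem ofTensorFun_add_left (α α' β : Cₛ^∞⟮I; F →L[ℝ] ℝ, DualBundle V⟯) :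
    S.ofTensorFun r (α + α') β = S.ofTensorFun r α β + S.ofTensorFun r α' β := by
  refine eq_of_pairing_left fun X => ?_
  simp only [pairing_add_left, pairing_ofTensorFun, formDeriv, dual_add_right, TensorSection.form_add_left,
    TensorSection.sharp_add, dual_add_left, ρ.deriv_add]
  ring

theorem ofTensorFun_add_right (α β β' : Cₛ^∞⟮I; F →L[ℝ] ℝ, DualBundle V⟯) :
    S.ofTensorFun r α (β + β') = S.ofTensorFun r α β + S.ofTensorFun r α β' := by
  refine eq_of_pairing_left fun X => ?_
  simp only [pairing_add_left, pairing_ofTensorFun, formDeriv, dual_add_right, TensorSection.form_add_right,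
    ρ.deriv_add]
  ring

theorem ofTensorFun_smul_left (f : C^∞⟮I, M; ℝ⟯) (α β : Cₛ^∞⟮I; F →L[ℝ] ℝ, DualBundle V⟯) :
    S.ofTensorFun r (f • α) β = f • S.ofTensorFun r α β := by
  refine eq_of_pairing_left fun X => ?_
  simp only [pairing_smul_left, pairing_ofTensorFun, formDeriv, dual_leibniz, TensorSection.form_smul_left,
    TensorSection.form_add_left, TensorSection.sharp_smul, dual_smul_left, ρ.deriv_mul]
  ring

theorem ofTensorFun_leibniz (f : C^∞⟮I, M; ℝ⟯) (α β : Cₛ^∞⟮I; F →L[ℝ] ℝ, DualBundle V⟯) :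
    S.ofTensorFun r α (f • β) = f • S.ofTensorFun r α β + (r.anchor ρ).deriv α f • β := by
  refine eq_of_pairing_left fun X => ?_
  simp only [pairing_smul_left, pairing_add_left, pairing_ofTensorFun, formDeriv, dual_leibniz,
    TensorSection.form_smul_right, TensorSection.form_add_right, ρ.deriv_mul, TensorSection.anchor_deriv]
  ring

/-- The right-anchored product `T` on `(V*, M, ρ_r)` defined by `S` and `r`. -/
def ofTensor : RightAnchoredProduct (r.anchor ρ) where
  prod := LinearMap.mk₂ ℝ (S.ofTensorFun r) (S.ofTensorFun_add_left r)
    (fun c => S.ofTensorFun_smul_left r (ContMDiffMap.const c)) (S.ofTensorFun_add_right r)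
    (fun c α β => by
      refine (S.ofTensorFun_leibniz r (ContMDiffMap.const c) α β).trans ?_
      have h0 : (r.anchor ρ).deriv α (ContMDiffMap.const c) = 0 := by
        rw [TensorSection.anchor_deriv]
        exact ρ.deriv_const _ c
      rw [h0]
      ext x v
      simp only [ContMDiffSection.coe_add, Pi.add_apply, smul_section_apply,
        ContMDiffMap.coe_zero, Pi.zero_apply, zero_smul, add_zero]
      rfl)
  smul_left := S.ofTensorFun_smul_left r
  leibniz := S.ofTensorFun_leibniz r

/-- `Δ(r)(α, β) = r_#([α, β]_T) - [r_#(α), r_#(β)]_S`. -/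
def delta (α β : Cₛ^∞⟮I; F →L[ℝ] ℝ, DualBundle V⟯) : Cₛ^∞⟮I; F, V⟯ :=
  r.sharp ((S.ofTensor r).bracket α β) - S.bracket (r.sharp α) (r.sharp β)

/-- `Q_X Δ(r)(α, β) = [X, Δ(r)(α, β)]_S - Δ(r)(S*_X α, β) - Δ(r)(α, S*_X β)`. -/
def deltaDeriv (X : Cₛ^∞⟮I; F, V⟯) (α β : Cₛ^∞⟮I; F →L[ℝ] ℝ, DualBundle V⟯) :
    Cₛ^∞⟮I; F, V⟯ :=
  S.bracket X (S.delta r α β) - S.delta r (S.dual X α) β - S.delta r α (S.dual X β)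

end RightAnchoredProduct

end Dual

end
end LSAlgebroid

namespace LSAlgebroid
noncomputable section

/-! ### Derivations along the anchor, and curvature identities for a single product. -/

section Derivations
variable {E : Type*} [NormedAddCommGroup E] [NormedSpace ℝ E]
  {H : Type*} [TopologicalSpace H] {I : ModelWithCorners ℝ E H}
  {M : Type*} [TopologicalSpace M] [ChartedSpace H M] [IsManifold I ∞ M]
  {F : Type*} [NormedAddCommGroup F] [NormedSpace ℝ F]
  {V : M → Type*} [TopologicalSpace (TotalSpace F V)]
  [∀ x, AddCommGroup (V x)] [∀ x, Module ℝ (V x)] [∀ x, TopologicalSpace (V x)]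
  [FiberBundle F V] [VectorBundle ℝ F V]

/-! Everything reduces to two formulas for the dual product, `T*_α X = [r_# α, X]_S + r_#(S*_X α)`
(`predual_ofTensor`).

Compatibility: flatness of `S` and `S*` turns both kinds of mixed curvature, `R^∇(X, α)Y` paired
with `β` and `R^∇(α, X)β` paired with `Y`, into the same function `-(S²_{X,Y} r)(α, β)`. The first
compatibility condition is then symmetry in `X, Y`, which is automatic because the difference is the
curvature of `S` acting on `r`. The second is symmetry in `α, β`, that is, `S² 𝔞 = 0`. This is
`compatible_ofTensor_iff`.

Flatness of `T`: once `S² 𝔞 = 0`, the bracket `[·,·]_T` has a derivation rule under `S*_X`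
(`dual_bracket_ofTensor`). With the Jacobi identity for `[·,·]_S` it shows that the curvature of
`T*` on `X` is exactly `Q_X Δ(r)(α, β)` (`curvature_predual_ofTensor`). The curvature of `T*` is
minus the transpose of that of `T`, up to the failure of `ρ_r` to preserve brackets, and this
failure is `ρ(Δ(r)(α, β))`. Hence `≺γ, Q_X Δ≻ = -ρ(Δ).≺γ, X≻ - ≺R^T(α, β)γ, X≻`
(`pairing_deltaDeriv`).

If `ρ(Δ) = 0`, this makes `Q Δ = 0` equivalent to `R^T = 0`. Conversely `R^T = 0` forces `ρ(Δ) = 0`,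
because the anchor of any flat product preserves brackets (`anchor_delta`). -/

theorem Anchor.deriv_sub (ρ : Anchor I F V) (a : Cₛ^∞⟮I; F, V⟯) (f g : C^∞⟮I, M; ℝ⟯) :
    ρ.deriv a (f - g) = ρ.deriv a f - ρ.deriv a g := by
  rw [eq_sub_iff_add_eq, ← ρ.deriv_add, sub_add_cancel]

theorem Anchor.deriv_sub_left (ρ : Anchor I F V) (a b : Cₛ^∞⟮I; F, V⟯) (f : C^∞⟮I, M; ℝ⟯) :
    ρ.deriv (a - b) f = ρ.deriv a f - ρ.deriv b f := by
  rw [eq_sub_iff_add_eq, ← ρ.deriv_add_left, sub_add_cancel]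

theorem Anchor.deriv_eq_zero_of_apply_eq_zero (ρ : Anchor I F V) {a : Cₛ^∞⟮I; F, V⟯} {x : M}
    (h : ρ x (a x) = 0) (f : C^∞⟮I, M; ℝ⟯) : ρ.deriv a f x = 0 := by
  rw [ρ.deriv_apply, h, map_zero]

/-- Smooth functions separate tangent vectors. -/
theorem eq_zero_of_forall_mvfderiv_eq_zero [FiniteDimensional ℝ E] [T2Space M] {x : M}
    {v : TangentSpace I x} (h : ∀ f : C^∞⟮I, M; ℝ⟯, mvfderiv I f x v = 0) : v = 0 := by
  obtain ⟨ψ, hψ, hsupp⟩ := exists_cutoff (I := I) x (chart_source_mem_nhds H x)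
  have key : ∀ φ : E →L[ℝ] ℝ, φ v = 0 := by
    intro φ
    -- The test function is a linear functional of the chart at `x`, cut off by `ψ` to be globally
    -- smooth.
    have hsm : ContMDiff I 𝓘(ℝ, ℝ) ∞ (fun y => ψ y * φ (extChartAt I x y)) := by
      refine contMDiff_of_contMDiffOn_union_of_isOpen (s := (chartAt H x).source)
        (t := (tsupport ψ)ᶜ) ?_ ?_ ?_ (chartAt H x).open_source (isClosed_tsupport ψ).isOpen_compl
      · exact ψ.contMDiff.contMDiffOn.mul (φ.contMDiff.comp_contMDiffOn contMDiffOn_extChartAt)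
      · refine (contMDiffOn_const (c := (0 : ℝ))).congr fun y hy => ?_
        rw [image_eq_zero_of_notMem_tsupport hy, zero_mul]
      · exact Set.compl_subset_iff_union.mp (Set.compl_subset_compl.mpr hsupp)
    have h1 := h ⟨_, hsm⟩
    have h2 : (fun y => ψ y * φ (extChartAt I x y)) =ᶠ[𝓝 x] φ ∘ extChartAt I x := by
      filter_upwards [hψ] with y hy
      simp [hy]
    have h3 : HasMFDerivAt I 𝓘(ℝ, ℝ) (φ ∘ extChartAt I x) x
        (φ ∘L (mfderiv I 𝓘(ℝ, E) (extChartAt I x) x)) :=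
      HasMFDerivAt.comp x φ.hasMFDerivAt
        (mdifferentiableAt_extChartAt (mem_chart_source H x)).hasMFDerivAt
    -- The tangent space at `x` is modelled on `E` through the chart at `x` itself, so the
    -- derivative of that chart is the identity and the test function has derivative `φ`.
    rw [mfderiv_extChartAt_self] at h3
    have h4 := (h3.congr_of_eventuallyEq h2).mfderiv
    have h5 : mfderiv I 𝓘(ℝ, ℝ) (fun y => ψ y * φ (extChartAt I x y)) x v = 0 := h1
    rw [h4] at h5
    exact h5
  exact SeparatingDual.eq_zero_of_forall_dual_eq_zero (R := ℝ) (V := E) key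

namespace RightAnchoredProduct
variable {ρ : Anchor I F V} {S : RightAnchoredProduct ρ}

/-- The Leibniz rule makes the mixed first-order terms cancel; what prevents linearity over
functions is precisely the failure of the anchor to preserve brackets. A flat product therefore
constrains its anchor. -/
theorem curvature_smul_right (S : RightAnchoredProduct ρ) (f : C^∞⟮I, M; ℝ⟯)
    (a b c : Cₛ^∞⟮I; F, V⟯) :
    curvature (fun s t => S.prod s t) a b (f • c) = f • curvature (fun s t => S.prod s t) a b c +
      (ρ.deriv a (ρ.deriv b f) - ρ.deriv b (ρ.deriv a f) - ρ.deriv (S.bracket a b) f) • c := by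
  simp only [curvature, S.leibniz, map_add, bracket]
  ext x
  simp only [ContMDiffSection.coe_add, ContMDiffSection.coe_sub, Pi.add_apply, Pi.sub_apply,
    smul_section_apply, ContMDiffMap.coe_sub]
  module

theorem IsLeftSymmetric.prod_bracket (hS : S.IsLeftSymmetric) (a b c : Cₛ^∞⟮I; F, V⟯) :
    S.prod (S.bracket a b) c = S.prod a (S.prod b c) - S.prod b (S.prod a c) :=
  (sub_eq_zero.1 (hS a b c)).symm

/-- The bracket is the commutator of the product, so this is the first Bianchi identity: three
instances of flatness cancel all terms. -/
theorem IsLeftSymmetric.jacobi (hS : S.IsLeftSymmetric) (a b c : Cₛ^∞⟮I; F, V⟯) :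
    S.bracket (S.bracket a b) c = S.bracket a (S.bracket b c) - S.bracket b (S.bracket a c) := by
  have h1 := hS.prod_bracket a b c
  have h2 := hS.prod_bracket b c a
  have h3 := hS.prod_bracket a c b
  simp only [bracket, map_sub, LinearMap.sub_apply] at h1 h2 h3 ⊢
  rw [h1, sub_eq_iff_eq_add.1 h2, sub_eq_iff_eq_add.1 h3]
  abel

end RightAnchoredProduct

end Derivations

/-! ### Flatness forces the anchor to preserve brackets. -/

section LeftSymmetric
variable {E : Type*} [NormedAddCommGroup E] [NormedSpace ℝ E] [FiniteDimensional ℝ E]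
  {H : Type*} [TopologicalSpace H] {I : ModelWithCorners ℝ E H}
  {M : Type*} [TopologicalSpace M] [ChartedSpace H M] [IsManifold I ∞ M] [T2Space M]
  {F : Type*} [NormedAddCommGroup F] [NormedSpace ℝ F] [FiniteDimensional ℝ F]
  {V : M → Type*} [TopologicalSpace (TotalSpace F V)]
  [∀ x, AddCommGroup (V x)] [∀ x, Module ℝ (V x)] [∀ x, TopologicalSpace (V x)]
  [FiberBundle F V] [VectorBundle ℝ F V] [ContMDiffVectorBundle ∞ F V I]

namespace RightAnchoredProduct
variable {ρ : Anchor I F V} {S : RightAnchoredProduct ρ}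

/-- The anchor of a left symmetric algebroid intertwines the brackets. -/
theorem IsLeftSymmetric.deriv_bracket (hS : S.IsLeftSymmetric) (a b : Cₛ^∞⟮I; F, V⟯)
    (f : C^∞⟮I, M; ℝ⟯) :
    ρ.deriv (S.bracket a b) f = ρ.deriv a (ρ.deriv b f) - ρ.deriv b (ρ.deriv a f) := by
  rw [eq_comm, ← sub_eq_zero]
  ext x
  -- Over a zero fibre the curvature carries no information, but there the anchor is zero. Otherwise
  -- a section `c` with `c x ≠ 0` detects the coefficient in `curvature_smul_right`.
  rcases subsingleton_or_nontrivial (V x) with h | h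
  · have h0 : ∀ (c : Cₛ^∞⟮I; F, V⟯) (g : C^∞⟮I, M; ℝ⟯), ρ.deriv c g x = 0 := fun c =>
      ρ.deriv_eq_zero_of_apply_eq_zero (by rw [Subsingleton.elim (c x) 0, map_zero])
    simp only [ContMDiffMap.coe_sub, Pi.sub_apply, h0, sub_zero, ContMDiffMap.coe_zero,
      Pi.zero_apply]
  · obtain ⟨v, hv⟩ := exists_ne (0 : V x)
    obtain ⟨c, rfl⟩ := exists_section_eq (I := I) (F := F) x v
    have h1 := S.curvature_smul_right f a b c
    rw [hS, hS] at h1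
    have h2 := congrArg (fun s : Cₛ^∞⟮I; F, V⟯ => s x) h1
    simp only [ContMDiffSection.coe_add, Pi.add_apply, smul_section_apply,
      ContMDiffSection.coe_zero, Pi.zero_apply, smul_zero, zero_add] at h2
    exact (smul_eq_zero.1 h2.symm).resolve_right hv

end RightAnchoredProduct
end LeftSymmetric

/-! ### The tensor `r`, its skew part, and their derivatives along `S`. -/

section Tensor
variable {E : Type*} [NormedAddCommGroup E] [NormedSpace ℝ E]
  {H : Type*} [TopologicalSpace H] {I : ModelWithCorners ℝ E H}
  {M : Type*} [TopologicalSpace M] [ChartedSpace H M]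
  {F : Type*} [NormedAddCommGroup F] [NormedSpace ℝ F]
  {V : M → Type*} [TopologicalSpace (TotalSpace F V)]
  [∀ x, AddCommGroup (V x)] [∀ x, Module ℝ (V x)] [∀ x, TopologicalSpace (V x)]
  [∀ x, IsTopologicalAddGroup (V x)] [∀ x, ContinuousSMul ℝ (V x)]
  [FiberBundle F V] [VectorBundle ℝ F V]

theorem TensorSection.sharp_sub (r : TensorSection I F V)
    (α β : Cₛ^∞⟮I; F →L[ℝ] ℝ, DualBundle V⟯) : r.sharp (α - β) = r.sharp α - r.sharp β := by
  rw [eq_sub_iff_add_eq, ← r.sharp_add, sub_add_cancel]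

end Tensor

section Extension
variable {E : Type*} [NormedAddCommGroup E] [NormedSpace ℝ E] [FiniteDimensional ℝ E]
  {H : Type*} [TopologicalSpace H] {I : ModelWithCorners ℝ E H}
  {M : Type*} [TopologicalSpace M] [ChartedSpace H M] [IsManifold I ∞ M] [T2Space M]
  {F : Type*} [NormedAddCommGroup F] [NormedSpace ℝ F] [FiniteDimensional ℝ F]
  {V : M → Type*} [TopologicalSpace (TotalSpace F V)]
  [∀ x, AddCommGroup (V x)] [∀ x, Module ℝ (V x)] [∀ x, TopologicalSpace (V x)]
  [∀ x, IsTopologicalAddGroup (V x)] [∀ x, ContinuousSMul ℝ (V x)]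
  [FiberBundle F V] [VectorBundle ℝ F V] [ContMDiffVectorBundle ∞ F V I]

/-- Written as a sum of two equal terms to clear the factor `1/2`, so that later computations stay
in the ring of smooth functions. -/
theorem TensorSection.form_skewPart (r : TensorSection I F V)
    (α β : Cₛ^∞⟮I; F →L[ℝ] ℝ, DualBundle V⟯) :
    r.skewPart.form α β + r.skewPart.form α β = r.form α β - r.form β α := by
  ext x
  have h : r.skewPart.form α β x = (1 / 2 : ℝ) * (r.form α β x - r.form β α x) := by
    change β x (contract (V x) ((1 / 2 : ℝ) • (r.toFun x - TensorProduct.comm ℝ _ _ (r.toFun x)))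
      (α x)) = _
    simp only [map_smul, map_sub, _root_.smul_apply, _root_.sub_apply, contract_comm, smul_eq_mul]
    rfl
  rw [ContMDiffMap.coe_add, ContMDiffMap.coe_sub, Pi.add_apply, Pi.sub_apply, h]
  ring

namespace RightAnchoredProduct
variable {ρ : Anchor I F V} {S : RightAnchoredProduct ρ}

section
variable (S)

theorem dual_sub_left (X Y : Cₛ^∞⟮I; F, V⟯) (α : Cₛ^∞⟮I; F →L[ℝ] ℝ, DualBundle V⟯) :
    S.dual (X - Y) α = S.dual X α - S.dual Y α := by
  rw [eq_sub_iff_add_eq, ← S.dual_add_left, sub_add_cancel]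

theorem dual_sub_right (X : Cₛ^∞⟮I; F, V⟯) (α β : Cₛ^∞⟮I; F →L[ℝ] ℝ, DualBundle V⟯) :
    S.dual X (α - β) = S.dual X α - S.dual X β := by
  rw [eq_sub_iff_add_eq, ← S.dual_add_right, sub_add_cancel]

theorem dual_zero_left (α : Cₛ^∞⟮I; F →L[ℝ] ℝ, DualBundle V⟯) : S.dual 0 α = 0 := by
  simpa using S.dual_sub_left 0 0 α

theorem dual_zero_right (X : Cₛ^∞⟮I; F, V⟯) : S.dual X 0 = 0 := by
  simpa using S.dual_sub_right X 0 0

/-- `(S_X r)(α, β)` is the pairing of `β` with `(S_X r_#)(α)`. -/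
theorem formDeriv_form (r : TensorSection I F V) (X : Cₛ^∞⟮I; F, V⟯)
    (α β : Cₛ^∞⟮I; F →L[ℝ] ℝ, DualBundle V⟯) :
    S.formDeriv X r.form α β = pairing β (S.prod X (r.sharp α) - r.sharp (S.dual X α)) := by
  simp only [formDeriv, TensorSection.form, pairing_sub_right, pairing_dual]
  ring

theorem formDeriv₂_skewPart (r : TensorSection I F V) (X Y : Cₛ^∞⟮I; F, V⟯)
    (α β : Cₛ^∞⟮I; F →L[ℝ] ℝ, DualBundle V⟯) :
    S.formDeriv₂ X Y r.skewPart.form α β + S.formDeriv₂ X Y r.skewPart.form α β =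
      S.formDeriv₂ X Y r.form α β - S.formDeriv₂ X Y r.form β α := by
  have h1 : ∀ (Z : Cₛ^∞⟮I; F, V⟯) (γ δ : Cₛ^∞⟮I; F →L[ℝ] ℝ, DualBundle V⟯),
      S.formDeriv Z r.skewPart.form γ δ + S.formDeriv Z r.skewPart.form γ δ =
        S.formDeriv Z r.form γ δ - S.formDeriv Z r.form δ γ := by
    intro Z γ δ
    have e := congrArg (ρ.deriv Z) (r.form_skewPart γ δ)
    rw [ρ.deriv_add, ρ.deriv_sub] at e
    simp only [formDeriv]
    linear_combination e - r.form_skewPart (S.dual Z γ) δ - r.form_skewPart γ (S.dual Z δ)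
  have e := congrArg (ρ.deriv X) (h1 Y α β)
  rw [ρ.deriv_add, ρ.deriv_sub] at e
  have e1 := h1 Y (S.dual X α) β
  have e2 := h1 Y α (S.dual X β)
  have e3 := h1 (S.prod X Y) α β
  simp only [formDeriv₂]
  -- Only the three outer derivatives along `X` are unfolded; the inner ones must keep the shape of
  -- `h1`.
  rw [formDeriv.eq_def S X, formDeriv.eq_def S X, formDeriv.eq_def S X]
  linear_combination e - e1 - e2 - e3

/-- The compatibility condition appears as symmetry of `S² r` in `α, β`; this translates it into a
condition on the skew part. -/
theorem formDeriv₂_skewPart_eq_zero_iff (r : TensorSection I F V) (X Y : Cₛ^∞⟮I; F, V⟯)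
    (α β : Cₛ^∞⟮I; F →L[ℝ] ℝ, DualBundle V⟯) :
    S.formDeriv₂ X Y r.skewPart.form α β = 0 ↔
      S.formDeriv₂ X Y r.form α β = S.formDeriv₂ X Y r.form β α := by
  rw [← sub_eq_zero (b := S.formDeriv₂ X Y r.form β α), ← S.formDeriv₂_skewPart]
  refine ⟨fun h => by rw [h, add_zero], fun h => ?_⟩
  ext x
  have := congrArg (fun f : C^∞⟮I, M; ℝ⟯ => f x) h
  exact self_eq_neg.1 (eq_neg_of_add_eq_zero_left this)

/-- The dual of the product defined by `r` is `T*_α X = [r_# α, X] + r_# (S*_X α)`. -/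
theorem predual_ofTensor (r : TensorSection I F V) (α : Cₛ^∞⟮I; F →L[ℝ] ℝ, DualBundle V⟯)
    (X : Cₛ^∞⟮I; F, V⟯) :
    (S.ofTensor r).predual α X = S.bracket (r.sharp α) X + r.sharp (S.dual X α) := by
  refine eq_of_pairing_right fun β => ?_
  have h : pairing ((S.ofTensor r).prod α β) X =
    S.formDeriv X r.form α β + pairing (S.dual (r.sharp α) β) X := S.pairing_ofTensorFun r α β X
  -- The terms `ρ(r_# α).≺β, X≻` from `T*` and from `S*` cancel, leaving no derivative of the
  -- pairing.
  rw [pairing_predual, h, formDeriv_form, pairing_dual, TensorSection.anchor_deriv]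
  simp only [bracket, pairing_add_right, pairing_sub_right]
  ring

theorem pairing_ofTensor (r : TensorSection I F V) (α β : Cₛ^∞⟮I; F →L[ℝ] ℝ, DualBundle V⟯)
    (X : Cₛ^∞⟮I; F, V⟯) :
    pairing ((S.ofTensor r).prod α β) X =
      S.formDeriv X r.form α β + pairing (S.dual (r.sharp α) β) X := S.pairing_ofTensorFun r α β X

theorem formDeriv₂_apply (r : TensorSection I F V) (X Y : Cₛ^∞⟮I; F, V⟯)
    (α β : Cₛ^∞⟮I; F →L[ℝ] ℝ, DualBundle V⟯) :
    S.formDeriv₂ X Y r.form α β = ρ.deriv X (S.formDeriv Y r.form α β) -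
      S.formDeriv Y r.form (S.dual X α) β - S.formDeriv Y r.form α (S.dual X β) -
        S.formDeriv (S.prod X Y) r.form α β := rfl

/-- `(S²_{X,Y} r)(α, β)` is the pairing of `β` with `(S²_{X,Y} r_#)(α)`. -/
theorem formDeriv₂_form (r : TensorSection I F V) (X Y : Cₛ^∞⟮I; F, V⟯)
    (α β : Cₛ^∞⟮I; F →L[ℝ] ℝ, DualBundle V⟯) :
    S.formDeriv₂ X Y r.form α β = pairing β (
      S.prod X (S.prod Y (r.sharp α)) - S.prod X (r.sharp (S.dual Y α))
      - S.prod Y (r.sharp (S.dual X α)) + r.sharp (S.dual Y (S.dual X α))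
      - S.prod (S.prod X Y) (r.sharp α) + r.sharp (S.dual (S.prod X Y) α)) := by
  simp only [formDeriv₂_apply, formDeriv_form, pairing_add_right, pairing_sub_right, pairing_dual,
    ρ.deriv_sub]
  ring

end

/-! ### Consequences of flatness for `S*` and for `S² r`. -/

/-- The dual of a flat product is flat. -/
theorem IsLeftSymmetric.dual_bracket (hS : S.IsLeftSymmetric) (X Y : Cₛ^∞⟮I; F, V⟯)
    (α : Cₛ^∞⟮I; F →L[ℝ] ℝ, DualBundle V⟯) :
    S.dual (S.bracket X Y) α = S.dual X (S.dual Y α) - S.dual Y (S.dual X α) := by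
  refine eq_of_pairing_left fun Z => ?_
  simp only [pairing_sub_left, pairing_dual, hS.deriv_bracket, hS.prod_bracket, pairing_sub_right,
    ρ.deriv_sub]
  ring

/-- The difference of the two sides is the curvature of `S` acting on `r`, and it vanishes since
both `S` and `S*` are flat. -/
theorem IsLeftSymmetric.formDeriv₂_comm (hS : S.IsLeftSymmetric) (r : TensorSection I F V)
    (X Y : Cₛ^∞⟮I; F, V⟯) (α β : Cₛ^∞⟮I; F →L[ℝ] ℝ, DualBundle V⟯) :
    S.formDeriv₂ X Y r.form α β = S.formDeriv₂ Y X r.form α β := by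
  have h1 := congrArg (pairing β) (hS.prod_bracket X Y (r.sharp α))
  have h2 := congrArg (fun γ => pairing β (r.sharp γ)) (hS.dual_bracket X Y α)
  simp only [bracket, map_sub, LinearMap.sub_apply, pairing_sub_right, dual_sub_left,
    TensorSection.sharp_sub] at h1 h2
  simp only [formDeriv₂_form, pairing_sub_right, pairing_add_right]
  linear_combination h2 - h1

/-! ### Curvature of the extension to `V ⊕ V*`, for an arbitrary product on `V*`. -/

section
variable {ρ' : Anchor I (F →L[ℝ] ℝ) (DualBundle V)} (T : RightAnchoredProduct ρ')

theorem predual_add_left (α β : Cₛ^∞⟮I; F →L[ℝ] ℝ, DualBundle V⟯) (X : Cₛ^∞⟮I; F, V⟯) :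
    T.predual (α + β) X = T.predual α X + T.predual β X := by
  refine eq_of_pairing_right fun γ => ?_
  simp only [pairing_add_right, pairing_predual, ρ'.deriv_add_left, map_add, LinearMap.add_apply,
    pairing_add_left]
  ring

theorem predual_add_right (α : Cₛ^∞⟮I; F →L[ℝ] ℝ, DualBundle V⟯) (X Y : Cₛ^∞⟮I; F, V⟯) :
    T.predual α (X + Y) = T.predual α X + T.predual α Y := by
  refine eq_of_pairing_right fun γ => ?_
  simp only [pairing_add_right, pairing_predual, ρ'.deriv_add]
  ring

theorem predual_zero_left (X : Cₛ^∞⟮I; F, V⟯) : T.predual 0 X = 0 := by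
  simpa using T.predual_add_left 0 0 X

theorem predual_zero_right (α : Cₛ^∞⟮I; F →L[ℝ] ℝ, DualBundle V⟯) : T.predual α 0 = 0 := by
  simpa using T.predual_add_right α 0 0

/-- The extension preserves each summand in its second argument, so each compatibility condition is
an equation in one bundle only. -/
theorem curvature_extension_left (X Y : Cₛ^∞⟮I; F, V⟯)
    (α : Cₛ^∞⟮I; F →L[ℝ] ℝ, DualBundle V⟯) :
    curvature (extension S T) (X, 0) (0, α) (Y, 0) =
      (S.prod X (T.predual α Y) - T.predual α (S.prod X Y) - T.predual (S.dual X α) Y +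
        S.prod (T.predual α X) Y, 0) := by
  simp only [curvature, extension, map_zero, LinearMap.zero_apply, dual_zero_right,
    predual_zero_left, predual_zero_right, add_zero, zero_add, Prod.mk_sub_mk, sub_zero, zero_sub,
    map_neg, LinearMap.neg_apply]
  refine Prod.ext ?_ rfl
  change _ - _ - (_ + _) = _
  abel_nf

theorem curvature_extension_right (X : Cₛ^∞⟮I; F, V⟯)
    (α β : Cₛ^∞⟮I; F →L[ℝ] ℝ, DualBundle V⟯) :
    curvature (extension S T) (0, α) (X, 0) (0, β) =
      (0, T.prod α (S.dual X β) - S.dual X (T.prod α β) - S.dual (T.predual α X) β +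
        T.prod (S.dual X α) β) := by
  simp only [curvature, extension, map_zero, LinearMap.zero_apply, dual_zero_left, dual_zero_right,
    predual_zero_right, add_zero, zero_add, Prod.mk_sub_mk, sub_zero, zero_sub,
    map_neg, LinearMap.neg_apply]
  refine Prod.ext rfl ?_
  change _ - _ - (_ + -_) = _
  abel_nf

/-- The curvature of the dual of `T` in terms of the curvature of `T`. -/
theorem pairing_curvature_predual (α β γ : Cₛ^∞⟮I; F →L[ℝ] ℝ, DualBundle V⟯)
    (X : Cₛ^∞⟮I; F, V⟯) :
    pairing γ (T.predual α (T.predual β X) - T.predual β (T.predual α X) -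
        T.predual (T.bracket α β) X) =
      ρ'.deriv α (ρ'.deriv β (pairing γ X)) - ρ'.deriv β (ρ'.deriv α (pairing γ X)) -
        ρ'.deriv (T.bracket α β) (pairing γ X) -
          pairing (curvature (fun s t => T.prod s t) α β γ) X := by
  simp only [curvature, bracket, pairing_sub_right, pairing_sub_left, pairing_predual,
    ρ'.deriv_sub, ρ'.deriv_sub_left, map_sub, LinearMap.sub_apply]
  ring

end

/-! ### Compatibility of `S` with the product defined by `r`. -/

variable (r : TensorSection I F V)

/-- After inserting the formula for `T*`, the terms involving `S_{r_# α}` form the curvature of `S`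
at `(r_# α, X)`, which is zero; the rest is `-S²_{X,Y} r_#` applied to `α`. -/
theorem IsLeftSymmetric.pairing_curvature_extension_left (hS : S.IsLeftSymmetric)
    (X Y : Cₛ^∞⟮I; F, V⟯) (α β : Cₛ^∞⟮I; F →L[ℝ] ℝ, DualBundle V⟯) :
    pairing β (S.prod X ((S.ofTensor r).predual α Y) - (S.ofTensor r).predual α (S.prod X Y) -
      (S.ofTensor r).predual (S.dual X α) Y + S.prod ((S.ofTensor r).predual α X) Y) =
        -S.formDeriv₂ X Y r.form α β := by
  have h1 := congrArg (pairing β) (hS.prod_bracket (r.sharp α) X Y)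
  simp only [bracket, map_sub, LinearMap.sub_apply, pairing_sub_right] at h1
  simp only [formDeriv₂_form, predual_ofTensor, bracket, map_sub, map_add, LinearMap.sub_apply,
    LinearMap.add_apply, pairing_sub_right, pairing_add_right]
  linear_combination h1

/-- Dual to the preceding computation: the curvature of `S*` at `(r_# α, X)` now drops out, and the
same function remains. -/
theorem IsLeftSymmetric.pairing_curvature_extension_right (hS : S.IsLeftSymmetric)
    (X Y : Cₛ^∞⟮I; F, V⟯) (α β : Cₛ^∞⟮I; F →L[ℝ] ℝ, DualBundle V⟯) :
    pairing ((S.ofTensor r).prod α (S.dual X β) - S.dual X ((S.ofTensor r).prod α β) -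
      S.dual ((S.ofTensor r).predual α X) β + (S.ofTensor r).prod (S.dual X α) β) Y =
        -S.formDeriv₂ X Y r.form α β := by
  have h1 := congrArg (fun γ => pairing γ Y) (hS.dual_bracket (r.sharp α) X β)
  have h2 := S.pairing_dual X (S.dual (r.sharp α) β) Y
  simp only [pairing_sub_left] at h1
  simp only [pairing_sub_left, pairing_add_left, pairing_ofTensor,
    S.pairing_dual X ((S.ofTensor r).prod α β), predual_ofTensor, dual_add_left, formDeriv₂_apply,
    ρ.deriv_add]
  linear_combination h2 - h1

/-- Compatibility with the product defined by `r` only involves the skew-symmetric part of `r`. -/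
theorem IsLeftSymmetric.compatible_ofTensor_iff (hS : S.IsLeftSymmetric) :
    S.Compatible (S.ofTensor r) ↔ ∀ (X Y : Cₛ^∞⟮I; F, V⟯)
      (α β : Cₛ^∞⟮I; F →L[ℝ] ℝ, DualBundle V⟯), S.formDeriv₂ X Y r.skewPart.form α β = 0 := by
  simp only [formDeriv₂_skewPart_eq_zero_iff, Compatible, curvature_extension_left,
    curvature_extension_right, Prod.mk.injEq, and_true, true_and]
  constructor
  · rintro ⟨-, h⟩ X Y α β
    have e := congrArg (fun γ => pairing γ Y) (h α β X)
    simp only [hS.pairing_curvature_extension_right] at e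
    exact neg_injective e
  · refine fun h => ⟨fun X Y α => eq_of_pairing_right fun β => ?_,
      fun α β X => eq_of_pairing_left fun Y => ?_⟩
    -- This half holds for every `r`, by symmetry of `S² r` in `X, Y`.
    · rw [hS.pairing_curvature_extension_left, hS.pairing_curvature_extension_left,
        hS.formDeriv₂_comm]
    · rw [hS.pairing_curvature_extension_right, hS.pairing_curvature_extension_right, h]

/-! ### The curvature of `T` and the obstruction `Δ(r)`. -/

/-- The bracket of `α` and `β` paired with `X`. -/
theorem pairing_bracket_ofTensor (α β : Cₛ^∞⟮I; F →L[ℝ] ℝ, DualBundle V⟯) (X : Cₛ^∞⟮I; F, V⟯) :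
    pairing ((S.ofTensor r).bracket α β) X =
      S.formDeriv X r.form α β - S.formDeriv X r.form β α +
        pairing (S.dual (r.sharp α) β - S.dual (r.sharp β) α) X := by
  simp only [bracket, pairing_sub_left, pairing_ofTensor]
  ring

/-- This is the condition `R^∇(α, X)β = R^∇(β, X)α` solved for `S*_X [α, β]_T`: the last four terms
are `S*_{T*_β X} α - S*_{T*_α X} β`. It measures how far `S*_X` is from a derivation of `[·,·]_T`.
-/
theorem IsLeftSymmetric.dual_bracket_ofTensor (hS : S.IsLeftSymmetric) (X : Cₛ^∞⟮I; F, V⟯)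
    (α β : Cₛ^∞⟮I; F →L[ℝ] ℝ, DualBundle V⟯)
    (h : ∀ Y, S.formDeriv₂ X Y r.skewPart.form α β = 0) :
    S.dual X ((S.ofTensor r).bracket α β) =
      (S.ofTensor r).bracket α (S.dual X β) + (S.ofTensor r).bracket (S.dual X α) β
      + S.dual (S.bracket (r.sharp β) X) α - S.dual (S.bracket (r.sharp α) X) β
      + S.dual (r.sharp (S.dual X β)) α - S.dual (r.sharp (S.dual X α)) β := by
  refine eq_of_pairing_left fun Y => ?_
  have h0 := (S.formDeriv₂_skewPart_eq_zero_iff r X Y α β).1 (h Y)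
  have h2 := S.pairing_dual X (S.dual (r.sharp α) β) Y
  have h3 := S.pairing_dual X (S.dual (r.sharp β) α) Y
  rw [formDeriv₂_apply, formDeriv₂_apply] at h0
  rw [hS.dual_bracket, hS.dual_bracket, pairing_dual]
  simp only [pairing_bracket_ofTensor, pairing_sub_left, pairing_add_left, ρ.deriv_add,
    ρ.deriv_sub]
  linear_combination h0 - h2 + h3

theorem sharp_bracket_ofTensor (α β : Cₛ^∞⟮I; F →L[ℝ] ℝ, DualBundle V⟯) :
    r.sharp ((S.ofTensor r).bracket α β) =
      S.bracket (r.sharp α) (r.sharp β) + S.delta r α β := by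
  rw [delta, add_sub_cancel]

/-- The curvature of the dual of the product defined by `r`. -/
theorem IsLeftSymmetric.curvature_predual_ofTensor (hS : S.IsLeftSymmetric) (X : Cₛ^∞⟮I; F, V⟯)
    (α β : Cₛ^∞⟮I; F →L[ℝ] ℝ, DualBundle V⟯)
    (h : ∀ Y, S.formDeriv₂ X Y r.skewPart.form α β = 0) :
    (S.ofTensor r).predual α ((S.ofTensor r).predual β X) -
      (S.ofTensor r).predual β ((S.ofTensor r).predual α X) -
        (S.ofTensor r).predual ((S.ofTensor r).bracket α β) X = S.deltaDeriv r X α β := by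
  -- Applying `r_#` replaces each `T`-bracket by an `S`-bracket plus a value of `Δ(r)`. The
  -- `S`-brackets cancel by Jacobi, and the values of `Δ(r)` assemble into `Q_X Δ(r)`.
  have h1 := congrArg r.sharp (hS.dual_bracket_ofTensor r X α β h)
  have h2 := (hS.jacobi (r.sharp α) (r.sharp β) X).symm
  simp only [TensorSection.sharp_add, TensorSection.sharp_sub, sharp_bracket_ofTensor] at h1
  simp only [predual_ofTensor, dual_add_left, TensorSection.sharp_add, deltaDeriv,
    sharp_bracket_ofTensor, h1]
  simp only [bracket, map_add, map_sub, LinearMap.add_apply, LinearMap.sub_apply] at h2 ⊢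
  rw [← sub_eq_zero] at h2 ⊢
  rw [← h2]
  abel

/-- The identity behind both directions. As `ρ_r = ρ ∘ r_#` and `ρ` sends `[r_# α, r_# β]_S` to the
commutator of derivations, the derivative terms in the curvature of `T*` collapse to `-ρ(Δ(r)(α,
β))`. -/
theorem IsLeftSymmetric.pairing_deltaDeriv (hS : S.IsLeftSymmetric) (X : Cₛ^∞⟮I; F, V⟯)
    (α β γ : Cₛ^∞⟮I; F →L[ℝ] ℝ, DualBundle V⟯)
    (h : ∀ Y, S.formDeriv₂ X Y r.skewPart.form α β = 0) :
    pairing γ (S.deltaDeriv r X α β) = -ρ.deriv (S.delta r α β) (pairing γ X) -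
      pairing (curvature (fun s t => (S.ofTensor r).prod s t) α β γ) X := by
  rw [← hS.curvature_predual_ofTensor r X α β h, pairing_curvature_predual]
  simp only [TensorSection.anchor_deriv]
  rw [← hS.deriv_bracket, delta, ρ.deriv_sub_left]
  ring

/-- Both `S` and `T` are flat, so both anchors preserve brackets: `r_#[α, β]_T` and `[r_# α, r_#
β]_S` act on functions by the same commutator. Compatibility plays no role here. -/
theorem IsLeftSymmetric.anchor_delta (hS : S.IsLeftSymmetric)
    (hT : (S.ofTensor r).IsLeftSymmetric) (α β : Cₛ^∞⟮I; F →L[ℝ] ℝ, DualBundle V⟯) (x : M) :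
    ρ x (S.delta r α β x) = 0 := by
  refine eq_zero_of_forall_mvfderiv_eq_zero (I := I) fun f => ?_
  have h := hT.deriv_bracket α β f
  simp only [TensorSection.anchor_deriv] at h
  rw [← ρ.deriv_apply, delta, ρ.deriv_sub_left, h, hS.deriv_bracket, sub_self]
  rfl

end RightAnchoredProduct
end Extension

end
end LSAlgebroid

/-! ### The equivalence. -/

theorem theorem4p1
    {E : Type*} [NormedAddCommGroup E] [NormedSpace ℝ E] [FiniteDimensional ℝ E]
    {H : Type*} [TopologicalSpace H] {I : ModelWithCorners ℝ E H}
    {M : Type*} [TopologicalSpace M] [ChartedSpace H M] [IsManifold I ∞ M] [T2Space M]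
    {F : Type*} [NormedAddCommGroup F] [NormedSpace ℝ F] [FiniteDimensional ℝ F]
    {A : M → Type*} [TopologicalSpace (TotalSpace F A)]
    [∀ x, AddCommGroup (A x)] [∀ x, Module ℝ (A x)] [∀ x, TopologicalSpace (A x)]
    [∀ x, IsTopologicalAddGroup (A x)] [∀ x, ContinuousSMul ℝ (A x)]
    [FiberBundle F A] [VectorBundle ℝ F A] [ContMDiffVectorBundle ∞ F A I]
    (ρ : LSAlgebroid.Anchor I F A) (S : LSAlgebroid.RightAnchoredProduct ρ)
    (hS : S.IsLeftSymmetric) (r : LSAlgebroid.TensorSection I F A) :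
    ((S.ofTensor r).IsLeftSymmetric ∧ S.Compatible (S.ofTensor r)) ↔
      ((∀ (α β : Cₛ^∞⟮I; F →L[ℝ] ℝ, LSAlgebroid.DualBundle A⟯) (x : M),
          ρ x (S.delta r α β x) = 0) ∧
        (∀ (X Y : Cₛ^∞⟮I; F, A⟯) (α β : Cₛ^∞⟮I; F →L[ℝ] ℝ, LSAlgebroid.DualBundle A⟯),
          S.formDeriv₂ X Y r.skewPart.form α β = 0) ∧
        (∀ (X : Cₛ^∞⟮I; F, A⟯) (α β : Cₛ^∞⟮I; F →L[ℝ] ℝ, LSAlgebroid.DualBundle A⟯),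
          S.deltaDeriv r X α β = 0)) := by
  constructor
  · rintro ⟨hT, hc⟩
    have h := (hS.compatible_ofTensor_iff r).1 hc
    have hρ := hS.anchor_delta r hT
    refine ⟨hρ, h, fun X α β => LSAlgebroid.eq_of_pairing_right fun γ => ?_⟩
    have h0 : ρ.deriv (S.delta r α β) (LSAlgebroid.pairing γ X) = 0 :=
      ContMDiffMap.ext fun x => ρ.deriv_eq_zero_of_apply_eq_zero (hρ α β x) _
    rw [hS.pairing_deltaDeriv r X α β γ fun Y => h X Y α β, hT, h0]
    ext x
    change -(0 : ℝ) - 0 = γ x 0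
    rw [map_zero, neg_zero, sub_zero]
  · rintro ⟨hρ, h, hQ⟩
    refine ⟨fun α β γ => LSAlgebroid.eq_of_pairing_left fun X => ?_,
      (hS.compatible_ofTensor_iff r).2 h⟩
    have h0 : ρ.deriv (S.delta r α β) (LSAlgebroid.pairing γ X) = 0 :=
      ContMDiffMap.ext fun x => ρ.deriv_eq_zero_of_apply_eq_zero (hρ α β x) _
    -- With `ρ(Δ) = 0` and `Q Δ = 0`, the only surviving term of the identity is the curvature of
    -- `T`.
    have h1 := hS.pairing_deltaDeriv r X α β γ fun Y => h X Y α β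
    have h2 : LSAlgebroid.pairing γ (0 : Cₛ^∞⟮I; F, A⟯) = 0 :=
      ContMDiffMap.ext fun x => map_zero (γ x)
    rw [hQ, h0, h2, neg_zero, zero_sub, eq_comm, neg_eq_zero] at h1
    exact h1
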